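/- \textbf{Definitions.} Let $K$ be an infinite countable field. A \emph{double Følner sequence} in $K$ is a sequence $(F_N)_{N\in\mathbb N}$ of finite subsets of $K$ such that for every $u\in K\setminus\{0\}$ $$\lim_{N\to\infty}\frac{|F_N\cap(F_N+u)|}{|F_N|}=\lim_{N\to\infty}\frac{|F_N\cap(F_Nu)|}{|F_N|}=1 ,$$ and for $E\subset K$ we put $\bar d_{(F_N)}(E)=\limsup_{N\to\infty}|E\cap F_N|/|F_N|$. A subset $S$ of an integral domain $R$ is \emph{affinely syndetic} if there are finitely many maps $g_1,\dots,g_k$ of the form $g_j(x)=a_jx+b_j$, with $a_j\in R\setminus\{0\}$ and $b_j\in R$, such that for every $x\in R$ at least one of $g_1(x),\dots,g_k(x)$ lies in $S$. Let $R$ be a subring of $K$, let $T\subset R$ and $C\subset K$. We say that $C$ \emph{contains many pairs $\{x+n,xn\}$ with $x\in K$, $n\in T$} if the following two conditions hold. (a) There is a double Følner sequence $(F_N)$ in $K$ with $\bar d_{(F_N)}(C)>0$. (b) For every double Følner sequence $(F_N)$ in $K$ with $\bar d_{(F_N)}(C)>0$ and every $\varepsilon>0$, the set $$\Big\{n\in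 T\setminus\{0\}:\ \bar d_{(F_N)}\big(\{x\in K:\{x+n,xn\}\subset C\}\big)>\bar d_{(F_N)}(C)^2-\varepsilon\Big\}$$ is affinely syndetic in $R$. \textbf{Theorem.} \begin{enumerate} \item For any $r\in\mathbb N$ and any sets with $\mathbb Q=C_1\cup\cdots\cup C_r$ there is $i\in\{1,\dots,r\}$ such that $C_i$ contains many pairs $\{x+n,xn\}$ with $x\in\mathbb Q$ and $n\in\mathbb N$ (here $K=\mathbb Q$, $R=\mathbb Z$, $T=\mathbb N$). \item Let $K$ be a number field with ring of integers $\mathcal O_K$. For any $r\in\mathbb N$ and any sets with $K=C_1\cup\cdots\cup C_r$ there is $i\in\{1,\dots,r\}$ such that $C_i$ contains many pairs $\{x+n,xn\}$ with $x\in K$ and $n\in\mathcal O_K$ (here $R=T=\mathcal O_K$). \item Let $\mathbb F$ be a finite field and let $K=\mathbb F(t)$ be the field of rational functions over $\mathbb F$. For any $r\in\mathbb N$ and any sets with $K=C_1\cup\cdots\cup C_r$ there is $i\in\{1,\dots,r\}$ such that $C_i$ contains many pairs $\{f+g,fg\}$ with $f\in K$ and $g\in\mathbb F[t]$ (here $R=T=\mathbb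 F[t]$). \end{enumerate} -/

import Mathlib

open Filter Topology Polynomial NumberField

noncomputable section

open scoped Classical in
/-- A double Følner sequence in a field: a sequence of finite sets that is asymptotically
invariant under every translation and under every multiplication by a non-zero element.
(A limit equal to `1` forces `F N` to be non-empty for all large `N`.) -/
def IsDoubleFolner {K : Type*} [Field K] (F : ℕ → Finset K) : Prop :=
  ∀ u : K, u ≠ 0 →
    Tendsto (fun N => ((F N ∩ (F N).image (fun x => x + u)).card : ℝ) / ((F N).card : ℝ))
      atTop (𝓝 1) ∧
    Tendsto (fun N => ((F N ∩ (F N).image (fun x => x * u)).card : ℝ) / ((F N).card : ℝ))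
      atTop (𝓝 1)

open scoped Classical in
/-- The upper density of `E` with respect to the sequence `F`: the limit superior of
`|E ∩ F N| / |F N|`. -/
def upperDensity {K : Type*} (F : ℕ → Finset K) (E : Set K) : ℝ :=
  limsup (fun N => (((F N).filter (fun x => x ∈ E)).card : ℝ) / ((F N).card : ℝ)) atTop

/-- A subset `S` of a ring `R` is affinely syndetic if there are finitely many affine maps
`x ↦ a * x + b` with `a ≠ 0` (here coded as pairs `(a, b)`) such that every `x` is sent into `S`
by at least one of them. -/
def IsAffinelySyndetic {R : Type*} [CommRing R] (S : Set R) : Prop :=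
  ∃ G : Finset (R × R), (∀ g ∈ G, g.1 ≠ 0) ∧ ∀ x : R, ∃ g ∈ G, g.1 * x + g.2 ∈ S

/-- The set of those `x` in `K` for which the pair `{x + n, x n}` is contained in `C`. -/
def pairBases {R K : Type*} [CommRing R] [Field K] [Algebra R K] (C : Set K) (n : R) : Set K :=
  {x : K | ({x + algebraMap R K n, x * algebraMap R K n} : Set K) ⊆ C}

/-- `C ⊆ K` contains many pairs `{x + n, x n}` with `x ∈ K` and `n ∈ T ⊆ R`:
`C` has positive upper density with respect to some double Følner sequence of `K`, and whenever
`C` has positive upper density `d` with respect to a double Følner sequence, then, for every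
`ε > 0`, the non-zero `n ∈ T` for which the set of `x` with `{x + n, x n} ⊆ C` has upper density
larger than `d ^ 2 - ε` form an affinely syndetic subset of `R`. -/
def HasManyPairs {R K : Type*} [CommRing R] [Field K] [Algebra R K]
    (T : Set R) (C : Set K) : Prop :=
  (∃ F : ℕ → Finset K, IsDoubleFolner F ∧ 0 < upperDensity F C) ∧
  ∀ F : ℕ → Finset K, IsDoubleFolner F → 0 < upperDensity F C → ∀ ε : ℝ, 0 < ε →
    IsAffinelySyndetic
      {n : R | n ∈ T ∧ n ≠ 0 ∧ upperDensity F C ^ 2 - ε < upperDensity F (pairBases C n)}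

end

/-! ### Invariant vectors in closed convex hulls of orbits -/

/-- The closed convex hull of an orbit of a commuting family of isometries of a Hilbert space
contains an invariant vector, namely its element of minimal norm. -/
theorem exists_invariant_mem_closure_convexHull {H Γ : Type*} [NormedAddCommGroup H]
    [InnerProductSpace ℝ H] [CompleteSpace H] [Nonempty Γ] (T : Γ → H →ₗᵢ[ℝ] H) (v : H)
    (hT : ∀ a b, ∃ c, T a (T b v) = T c v) :
    ∃ w ∈ closure (convexHull ℝ (Set.range fun a => T a v)), ∀ a, T a w = w := by
  set S := closure (convexHull ℝ (Set.range fun a => T a v)) with hS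
  have hne : S.Nonempty :=
    ((Set.range_nonempty _).mono (subset_convexHull ℝ _)).mono subset_closure
  have hconv : Convex ℝ S := (convex_convexHull ℝ _).closure
  obtain ⟨w, hw, hmin⟩ := exists_norm_eq_iInf_of_complete_convex hne
    isClosed_closure.isComplete hconv 0
  rw [norm_eq_iInf_iff_real_inner_le_zero hconv hw] at hmin
  refine ⟨w, hw, fun a => ?_⟩
  have hmaps : T a w ∈ S := by
    have h1 : T a w ∈ T a '' S := ⟨w, hw, rfl⟩
    have h2 := image_closure_subset_closure_image (T a).continuous h1
    refine closure_mono ?_ h2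
    have h3 := (T a).toLinearMap.image_convexHull (Set.range fun a => T a v)
    rw [LinearIsometry.coe_toLinearMap] at h3
    rw [h3]
    refine convexHull_mono ?_
    rintro _ ⟨_, ⟨b, rfl⟩, rfl⟩
    obtain ⟨c, hc⟩ := hT a b
    exact ⟨c, hc.symm⟩
  have h1 := hmin _ hmaps
  rw [zero_sub, inner_neg_left, inner_sub_right, real_inner_self_eq_norm_sq] at h1
  have h2 : ‖T a w - w‖ ^ 2 ≤ 0 := by
    rw [@norm_sub_sq_real, (T a).norm_map, real_inner_comm]
    linarith
  have h3 : ‖T a w - w‖ = 0 := by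
    have := norm_nonneg (T a w - w)
    nlinarith
  exact sub_eq_zero.1 (norm_eq_zero.1 h3)

/-- A finitely supported probability distribution on `Γ`, with support indexed by a finite set. -/
structure FinitePMF (Γ : Type*) where
  /-- the index type -/
  ι : Type
  /-- the index set -/
  s : Finset ι
  /-- the weights -/
  wt : ι → ℝ
  /-- the points -/
  pt : ι → Γ
  wt_nonneg : ∀ i ∈ s, 0 ≤ wt i
  sum_wt : ∑ i ∈ s, wt i = 1

/-- The average of a real function with respect to a finite distribution. -/
def FinitePMF.avg {Γ : Type*} (μ : FinitePMF Γ) (φ : Γ → ℝ) : ℝ :=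
  ∑ i ∈ μ.s, μ.wt i * φ (μ.pt i)

namespace FinitePMF

variable {Γ : Type*} (μ : FinitePMF Γ)

theorem avg_mono {φ ψ : Γ → ℝ} (h : ∀ i ∈ μ.s, φ (μ.pt i) ≤ ψ (μ.pt i)) :
    μ.avg φ ≤ μ.avg ψ :=
  Finset.sum_le_sum fun i hi => mul_le_mul_of_nonneg_left (h i hi) (μ.wt_nonneg i hi)

theorem avg_const (c : ℝ) : μ.avg (fun _ => c) = c := by
  simp only [avg, ← Finset.sum_mul, μ.sum_wt, one_mul]

theorem avg_add (φ ψ : Γ → ℝ) : μ.avg (fun a => φ a + ψ a) = μ.avg φ + μ.avg ψ := by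
  simp only [avg, mul_add, Finset.sum_add_distrib]

theorem avg_const_mul (c : ℝ) (φ : Γ → ℝ) : μ.avg (fun a => c * φ a) = c * μ.avg φ := by
  simp only [avg, Finset.mul_sum]
  exact Finset.sum_congr rfl fun i _ => by ring

theorem avg_sum {ι : Type*} (s : Finset ι) (φ : ι → Γ → ℝ) :
    μ.avg (fun a => ∑ j ∈ s, φ j a) = ∑ j ∈ s, μ.avg (φ j) := by
  simp only [avg, Finset.mul_sum]
  exact Finset.sum_comm

theorem avg_inner {H : Type*} [NormedAddCommGroup H] [InnerProductSpace ℝ H] (x : Γ → H) (y : H) :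
    μ.avg (fun a => inner ℝ (x a) y) = inner ℝ (∑ i ∈ μ.s, μ.wt i • x (μ.pt i)) y := by
  simp only [avg, sum_inner, real_inner_smul_left]

end FinitePMF

theorem exists_finitePMF_of_mem_closure_convexHull {H Γ : Type*} [NormedAddCommGroup H]
    [InnerProductSpace ℝ H] {x : Γ → H} {w : H}
    (hw : w ∈ closure (convexHull ℝ (Set.range x))) {δ : ℝ} (hδ : 0 < δ) :
    ∃ μ : FinitePMF Γ, ‖(∑ i ∈ μ.s, μ.wt i • x (μ.pt i)) - w‖ < δ := by
  obtain ⟨y, hy, hyw⟩ := Metric.mem_closure_iff.1 hw δ hδ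
  rw [convexHull_eq] at hy
  obtain ⟨ι, t, c, z, h0, h1, hz, rfl⟩ := hy
  have hne : Nonempty Γ := by
    have : t.Nonempty := by
      rw [Finset.nonempty_iff_ne_empty]; rintro rfl; simp at h1
    obtain ⟨i, hi⟩ := this
    obtain ⟨a, -⟩ := hz i hi
    exact ⟨a⟩
  classical
  choose! p hp using hz
  refine ⟨⟨ι, t, c, p, h0, h1⟩, ?_⟩
  rw [dist_comm, dist_eq_norm, Finset.centerMass_eq_of_sum_1 _ _ h1] at hyw
  rwa [show ∑ i ∈ t, c i • x (p i) = ∑ i ∈ t, c i • z i from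
    Finset.sum_congr rfl fun i hi => by rw [hp i hi]]

/-! ### Isometric representations of the affine group of a field -/

/-- An isometric anti-representation of the affine group of the field `K`, given by the
translations `A v` and the dilations `M u`. -/
structure AffineRep (K H : Type*) [Field K] [NormedAddCommGroup H] [InnerProductSpace ℝ H] where
  /-- translations -/
  A : K → H →ₗᵢ[ℝ] H
  /-- dilations -/
  M : Kˣ → H →ₗᵢ[ℝ] H
  A_zero : ∀ x, A 0 x = x
  A_add : ∀ v w x, A (v + w) x = A v (A w x)
  M_one : ∀ x, M 1 x = x
  M_mul : ∀ u w x, M (u * w) x = M u (M w x)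
  A_M : ∀ v u x, A v (M u x) = M u (A (v * u) x)

namespace AffineRep

variable {K H : Type*} [Field K] [NormedAddCommGroup H] [InnerProductSpace ℝ H]
  (π : AffineRep K H)

theorem M_inv_apply (u : Kˣ) (x : H) : π.M u⁻¹ (π.M u x) = x := by
  rw [← π.M_mul, inv_mul_cancel, π.M_one]

theorem M_apply_inv (u : Kˣ) (x : H) : π.M u (π.M u⁻¹ x) = x := by
  rw [← π.M_mul, mul_inv_cancel, π.M_one]

theorem inner_M_left (u : Kˣ) (x y : H) : inner ℝ (π.M u x) y = inner ℝ x (π.M u⁻¹ y) := by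
  rw [← (π.M u⁻¹).inner_map_map, π.M_inv_apply]

theorem inner_A_left (v : K) (x y : H) : inner ℝ (π.A v x) y = inner ℝ x (π.A (-v) y) := by
  rw [← (π.A (-v)).inner_map_map, ← π.A_add, neg_add_cancel, π.A_zero]

theorem M_A (u : Kˣ) (v : K) (x : H) : π.M u (π.A v x) = π.A (v * ↑u⁻¹) (π.M u x) := by
  rw [π.A_M, Units.inv_mul_cancel_right]

/-- The vectors invariant under the translations by `p * r`, `r ∈ R`. -/
def inv (R : Subring K) (p : K) : Submodule ℝ H where
  carrier := {y | ∀ r ∈ R, π.A (p * r) y = y}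
  add_mem' := fun ha hb r hr => by rw [map_add, ha r hr, hb r hr]
  zero_mem' := fun r _ => map_zero _
  smul_mem' := fun c x hx r hr => by rw [map_smul, hx r hr]

theorem inv_mono {R : Subring K} {p q : K} (h : ∃ r ∈ R, q = p * r) : π.inv R p ≤ π.inv R q := by
  obtain ⟨r, hr, rfl⟩ := h
  intro y hy s hs
  rw [mul_assoc]
  exact hy _ (R.mul_mem hr hs)

theorem A_mem_inv {R : Subring K} {p : K} {y : H} (hy : y ∈ π.inv R p) (v : K) :
    π.A v y ∈ π.inv R p := fun r hr => by
  rw [← π.A_add, add_comm, π.A_add, hy r hr]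

theorem M_inv_mem_inv {R : Subring K} {p : K} {y : H} (hy : y ∈ π.inv R p) (u : Kˣ) :
    π.M u⁻¹ y ∈ π.inv R (p * u) := fun r hr => by
  rw [π.A_M, show p * u * r * ((u⁻¹ : Kˣ) : K) = p * r by
    rw [mul_right_comm, Units.mul_inv_cancel_right], hy r hr]

/-- The closed span of the vectors invariant under `p R` for some `p ∈ Γ`. -/
def rat (R : Subring K) (Γ : Submonoid Kˣ) : Submodule ℝ H :=
  (⨆ p : Γ, π.inv R ((p : Kˣ) : K)).topologicalClosure

theorem inv_le_rat {R : Subring K} {Γ : Submonoid Kˣ} {p : Kˣ} (hp : p ∈ Γ) :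
    π.inv R p ≤ π.rat R Γ :=
  (le_iSup (fun p : Γ => π.inv R ((p : Kˣ) : K)) ⟨p, hp⟩).trans
    (Submodule.le_topologicalClosure _)

theorem exists_mem_inv_of_mem_rat {R : Subring K} {Γ : Submonoid Kˣ}
    (hΓR : ∀ p ∈ Γ, (p : K) ∈ R) {v : H} (hv : v ∈ π.rat R Γ) {δ : ℝ} (hδ : 0 < δ) :
    ∃ p ∈ Γ, ∃ y ∈ π.inv R (p : K), ‖v - y‖ < δ := by
  have hdir : Directed (· ≤ ·) fun p : Γ => π.inv R ((p : Kˣ) : K) := fun p q =>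
    ⟨p * q, π.inv_mono ⟨_, hΓR q q.2, by simp⟩, π.inv_mono ⟨_, hΓR p p.2, by simp [mul_comm]⟩⟩
  obtain ⟨y, hy, hvy⟩ := Metric.mem_closure_iff.1 (show v ∈ closure _ from hv) δ hδ
  obtain ⟨p, hp⟩ := (Submodule.mem_iSup_of_directed _ hdir).1 hy
  exact ⟨p, p.2, y, hp, by rwa [← dist_eq_norm]⟩

theorem M_inv_mem_rat {R : Subring K} {Γ : Submonoid Kˣ}
    (hΓR : ∀ p ∈ Γ, (p : K) ∈ R) {v : H} (hv : v ∈ π.rat R Γ) {u : Kˣ} (hu : u ∈ Γ) :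
    π.M u⁻¹ v ∈ π.rat R Γ := by
  refine Metric.mem_closure_iff.2 fun δ hδ => ?_
  obtain ⟨p, hp, y, hy, h⟩ := π.exists_mem_inv_of_mem_rat hΓR hv hδ
  refine ⟨π.M u⁻¹ y, ?_, ?_⟩
  · have := π.M_inv_mem_inv hy u
    exact (le_iSup (fun p : Γ => π.inv R ((p : Kˣ) : K)) ⟨p * u, Γ.mul_mem hp hu⟩) (by simpa using this)
  · rwa [(π.M u⁻¹).isometry.dist_eq, dist_eq_norm]

theorem A_mem_rat {R : Subring K} {Γ : Submonoid Kˣ}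
    (hΓR : ∀ p ∈ Γ, (p : K) ∈ R) {v : H} (hv : v ∈ π.rat R Γ) (a : K) :
    π.A a v ∈ π.rat R Γ := by
  refine Metric.mem_closure_iff.2 fun δ hδ => ?_
  obtain ⟨p, hp, y, hy, h⟩ := π.exists_mem_inv_of_mem_rat hΓR hv hδ
  refine ⟨π.A a y, ?_, ?_⟩
  · exact (le_iSup (fun p : Γ => π.inv R ((p : Kˣ) : K)) ⟨p, hp⟩) (π.A_mem_inv hy a)
  · rwa [(π.A a).isometry.dist_eq, dist_eq_norm]

theorem A_mem_rat_orthogonal {R : Subring K} {Γ : Submonoid Kˣ}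
    (hΓR : ∀ p ∈ Γ, (p : K) ∈ R) {g : H} (hg : g ∈ (π.rat R Γ)ᗮ) (a : K) :
    π.A a g ∈ (π.rat R Γ)ᗮ := by
  rw [Submodule.mem_orthogonal'] at hg ⊢
  intro y hy
  rw [π.inner_A_left]
  exact hg _ (π.A_mem_rat hΓR hy _)

/-- Averages of translates of the part orthogonal to `rat` tend to zero, simultaneously along
finitely many dilates of `R`. -/
theorem exists_finitePMF_norm_lt [CompleteSpace H] {R : Subring K} {Γ : Submonoid Kˣ}
    (hΓR : ∀ p ∈ Γ, (p : K) ∈ R) (hdiv : ∀ k : Kˣ, ∃ p ∈ Γ, ∃ r ∈ R, (p : K) = k * r)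
    {g : H} (hg : g ∈ (π.rat R Γ)ᗮ) (W : Finset Kˣ) {δ : ℝ} (hδ : 0 < δ) :
    ∃ μ : FinitePMF R, ∀ w ∈ W, ‖∑ i ∈ μ.s, μ.wt i • π.A (w * μ.pt i) g‖ < δ := by
  let T : R → (PiLp 2 fun _ : W => H) →ₗᵢ[ℝ] (PiLp 2 fun _ : W => H) := fun c =>
    { toFun := fun x => WithLp.toLp 2 fun w => π.A (((w : Kˣ) : K) * (c : K)) (x w)
      map_add' := fun x y => by ext w; simp
      map_smul' := fun a x => by ext w; simp
      norm_map' := fun x => by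
        simp [PiLp.norm_eq_of_L2] }
  let v : (PiLp 2 fun _ : W => H) := WithLp.toLp 2 fun _ => g
  have hT : ∀ a b, ∃ c, T a (T b v) = T c v := fun a b => ⟨a + b, by
    ext w
    simp [T, mul_add, π.A_add]⟩
  obtain ⟨z, hz, hinv⟩ := exists_invariant_mem_closure_convexHull T v hT
  have hzorth : ∀ w, z w ∈ (π.rat R Γ)ᗮ := by
    intro w
    let ev : (PiLp 2 fun _ : W => H) →L[ℝ] H := PiLp.proj 2 (fun _ : W => H) w
    have hcl : IsClosed (ev ⁻¹' ((π.rat R Γ)ᗮ : Submodule ℝ H)) :=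
      ((π.rat R Γ).isClosed_orthogonal).preimage ev.continuous
    have hco : Convex ℝ (ev ⁻¹' ((π.rat R Γ)ᗮ : Submodule ℝ H)) :=
      ((π.rat R Γ)ᗮ.convex).linear_preimage ev.toLinearMap
    refine closure_minimal (convexHull_min ?_ hco) hcl hz
    rintro _ ⟨c, rfl⟩
    exact π.A_mem_rat_orthogonal hΓR hg _
  have hz0 : z = 0 := by
    ext w
    obtain ⟨p, hp, hr⟩ := hdiv w
    have h1 : z w ∈ π.inv R (w : Kˣ) := fun r hr => by
      have := congrArg (fun x : (PiLp 2 fun _ : W => H) => x w) (hinv ⟨r, hr⟩)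
      exact this
    have h2 := π.inv_le_rat hp (π.inv_mono hr h1)
    have h3 := (Submodule.mem_orthogonal _ _).1 (hzorth w) _ h2
    exact inner_self_eq_zero.1 h3
  obtain ⟨μ, hμ⟩ := exists_finitePMF_of_mem_closure_convexHull hz hδ
  refine ⟨μ, fun w hw => lt_of_le_of_lt ?_ hμ⟩
  rw [hz0, sub_zero]
  refine le_trans (le_of_eq ?_) (PiLp.norm_apply_le _ (⟨w, hw⟩ : W))
  rw [WithLp.ofLp_sum, Finset.sum_apply]
  rfl

end AffineRep

namespace AffineRep

variable {K H : Type*} [Field K] [NormedAddCommGroup H] [InnerProductSpace ℝ H]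
  (π : AffineRep K H)

theorem main_term [CompleteSpace H] {R : Subring K} {Γ : Submonoid Kˣ}
    (hΓR : ∀ p ∈ Γ, (p : K) ∈ R) {e f v : H} (he : ‖e‖ = 1) (heM : ∀ u, π.M u e = e)
    (heV : e ∈ π.rat R Γ) (hf : ‖f‖ ≤ 1) (hv : v ∈ π.rat R Γ) (hfv : f - v ∈ (π.rat R Γ)ᗮ)
    {ε : ℝ} (hε : 0 < ε) :
    ∃ u ∈ Γ, ∃ β : FinitePMF Γ, ∀ n ∈ Γ, inner ℝ f e ^ 2 - ε ≤
      β.avg (fun b => inner ℝ (π.A ((b * (u * n) : Kˣ) : K) v) (π.M (b * (u * n)) f)) := by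
  have hinner : ∀ y ∈ π.rat R Γ, inner ℝ y f = inner ℝ y v := fun y hy => by
    have := (Submodule.mem_orthogonal _ _).1 hfv y hy
    rw [inner_sub_right] at this
    linarith
  obtain ⟨w, hw, hinv⟩ := exists_invariant_mem_closure_convexHull
    (fun b : Γ => π.M (b : Kˣ)⁻¹) v (fun a b => ⟨b * a, by
      rw [← π.M_mul, Submonoid.coe_mul, mul_inv_rev]⟩)
  have hMw : ∀ u ∈ Γ, π.M u w = w := fun u hu => by
    conv_lhs => rw [← hinv ⟨u, hu⟩]
    exact π.M_apply_inv u w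
  have hwV : w ∈ π.rat R Γ := by
    refine closure_minimal (convexHull_min ?_ (π.rat R Γ).convex)
      (Submodule.isClosed_topologicalClosure _) hw
    rintro _ ⟨b, rfl⟩
    exact π.M_inv_mem_rat hΓR hv b.2
  have hconst : ∀ y : H, (∀ u ∈ Γ, π.M u y = y) → inner ℝ y w = inner ℝ y v := by
    intro y hy
    have hcl : IsClosed {x : H | inner ℝ y x = inner ℝ y v} :=
      isClosed_eq (by fun_prop) continuous_const
    have hco : Convex ℝ {x : H | inner ℝ y x = inner ℝ y v} :=
      convex_hyperplane (innerₛₗ ℝ y).isLinear _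
    refine closure_minimal (convexHull_min ?_ hco) hcl hw
    rintro _ ⟨b, rfl⟩
    show inner ℝ y (π.M (b : Kˣ)⁻¹ v) = _
    rw [← π.inner_M_left, hy _ b.2]
  have hwf : inner ℝ f e ^ 2 ≤ inner ℝ w f := by
    rw [hinner w hwV, ← hconst w hMw, real_inner_comm, hinner e heV, ← hconst e fun u _ => heM u,
      real_inner_self_eq_norm_sq]
    have h := abs_real_inner_le_norm e w
    rw [he, one_mul] at h
    rw [← sq_abs]
    exact pow_le_pow_left₀ (abs_nonneg _) h 2
  obtain ⟨u, hu, y, hy, hvy⟩ := π.exists_mem_inv_of_mem_rat hΓR hv (show 0 < ε / 3 by positivity)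
  obtain ⟨β, hβ⟩ := exists_finitePMF_of_mem_closure_convexHull hw (show 0 < ε / 3 by positivity)
  refine ⟨u, hu, β, fun n hn => ?_⟩
  have hMf : ∀ N, ‖π.M N f‖ ≤ 1 := fun N => by rwa [(π.M N).norm_map]
  have h1 : ∀ b : Γ, inner ℝ (π.M (b : Kˣ)⁻¹ v) (π.M (u * n) f) + -(2 * ε / 3) ≤
      inner ℝ (π.A ((b * (u * n) : Kˣ) : K) v) (π.M (b * (u * n)) f) := by
    intro b
    have hAy : π.A ((b * (u * n) : Kˣ) : K) y = y := by
      have := hy _ (R.mul_mem (hΓR _ b.2) (hΓR _ hn))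
      convert this using 3
      push_cast
      ring
    have hdiff : v - π.A ((b * (u * n) : Kˣ) : K) v =
        (v - y) - π.A ((b * (u * n) : Kˣ) : K) (v - y) := by
      rw [map_sub, hAy]; abel
    have hn1 : ‖v - π.A ((b * (u * n) : Kˣ) : K) v‖ ≤ 2 * ε / 3 := by
      rw [hdiff]
      refine (norm_sub_le _ _).trans ?_
      rw [(π.A _).norm_map]
      linarith
    have h2 : inner ℝ (π.M (b : Kˣ)⁻¹ v) (π.M (u * n) f) = inner ℝ v (π.M (b * (u * n)) f) := by
      rw [π.inner_M_left, inv_inv, ← π.M_mul]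
    have h3 := real_inner_le_norm (v - π.A ((b * (u * n) : Kˣ) : K) v) (π.M (b * (u * n)) f)
    rw [inner_sub_left] at h3
    have h4 : ‖v - π.A ((b * (u * n) : Kˣ) : K) v‖ * ‖π.M (b * (u * n)) f‖ ≤ 2 * ε / 3 :=
      (mul_le_of_le_one_right (norm_nonneg _) (hMf _)).trans hn1
    rw [h2]
    linarith
  refine le_trans ?_ (β.avg_mono (φ := fun b : Γ =>
    inner ℝ (π.M (b : Kˣ)⁻¹ v) (π.M (u * n) f) + -(2 * ε / 3)) fun i _ => h1 (β.pt i))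
  rw [β.avg_add, β.avg_const, β.avg_inner]
  have h5 : inner ℝ w (π.M (u * n) f) = inner ℝ w f := by
    rw [← (π.M (u * n)).inner_map_map w f, hMw _ (Γ.mul_mem hu hn)]
  have h6 := real_inner_le_norm (w - ∑ i ∈ β.s, β.wt i • π.M ((β.pt i : Γ) : Kˣ)⁻¹ v)
    (π.M (u * n) f)
  rw [inner_sub_left, norm_sub_rev] at h6
  have h7 := (mul_le_of_le_one_right (norm_nonneg _) (hMf (u * n))).trans hβ.le
  linarith

theorem inner_M_inv_A (m a b : Kˣ) (g : H) :
    inner ℝ (π.M (m * a)⁻¹ (π.A ((m * a : Kˣ) : K) g))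
      (π.M (m * b)⁻¹ (π.A ((m * b : Kˣ) : K) g)) =
    inner ℝ (π.A (m * ((a / b : K) - b / a) * b) g) (π.M b⁻¹ (π.M a g)) := by
  rw [← (π.M (m * a * b)).inner_map_map, ← π.M_mul, ← π.M_mul,
    show m * a * b * (m * a)⁻¹ = b by rw [mul_comm, inv_mul_cancel_left],
    show m * a * b * (m * b)⁻¹ = a by rw [mul_right_comm m a b, mul_inv_cancel_comm],
    π.M_A a, ← (π.A (-(((m * b : Kˣ) : K) * ↑a⁻¹))).inner_map_map, ← π.A_add, neg_add_cancel,
    π.A_zero, π.A_M, π.inner_M_left, ← π.A_add]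
  congr 3
  have ha := a.ne_zero
  have hb := b.ne_zero
  push_cast
  field_simp
  ring

theorem error_term [CompleteSpace H] {R : Subring K} {Γ : Submonoid Kˣ}
    (hΓR : ∀ p ∈ Γ, (p : K) ∈ R) (hdiv : ∀ k : Kˣ, ∃ p ∈ Γ, ∃ r ∈ R, (p : K) = k * r)
    (hinf : (Γ : Set Kˣ).Infinite) {f g : H} (hf : ‖f‖ ≤ 1) (hg1 : ‖g‖ ≤ 1)
    (hg : g ∈ (π.rat R Γ)ᗮ) (D : Finset Kˣ) {ε : ℝ} (hε : 0 < ε) :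
    ∃ (S : Finset Kˣ) (μ : FinitePMF R), S.Nonempty ∧ (∀ a ∈ S, a ∈ Γ) ∧
      ∀ d ∈ D, ∀ (x : R) (n : R → Kˣ), (∀ i ∈ μ.s, (n (μ.pt i) : K) = x + μ.pt i) →
        -ε ≤ μ.avg (fun c => (S.card : ℝ)⁻¹ * ∑ a ∈ S,
          inner ℝ (π.A ((d * n c * a : Kˣ) : K) g) (π.M (d * n c * a) f)) := by
  classical
  obtain ⟨k, hk⟩ := exists_nat_gt (2 / ε ^ 2)
  have hkpos : (0 : ℝ) < k := lt_trans (by positivity) hk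
  have hsq : ((fun a : Kˣ => (a : K) ^ 2) '' (Γ : Set Kˣ)).Infinite := by
    intro hfin
    refine hinf (Set.Finite.of_finite_fibers _ hfin ?_)
    rintro _ ⟨a, -, rfl⟩
    refine (Set.toFinite ({a, -a} : Set Kˣ)).subset ?_
    rintro b ⟨-, hb⟩
    rcases sq_eq_sq_iff_eq_or_eq_neg.1 (show (b : K) ^ 2 = a ^ 2 from hb) with h | h
    · exact Or.inl (Units.ext h)
    · exact Or.inr (Units.ext (by simpa using h))
  obtain ⟨S', hS', hcard'⟩ := hsq.exists_subset_card_eq k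
  obtain ⟨S, hSΓ, hSinj, rfl⟩ : ∃ S : Finset Kˣ, (S : Set Kˣ) ⊆ Γ ∧
      Set.InjOn (fun a : Kˣ => (a : K) ^ 2) S ∧ S.image (fun a : Kˣ => (a : K) ^ 2) = S' := by
    obtain ⟨S, h1, h2, h3⟩ := Finset.exists_subset_injOn_image_eq_of_surjOn (s := (Γ : Set Kˣ))
      (f := fun a : Kˣ => (a : K) ^ 2) S' hS'
    exact ⟨S, h1, h2, h3⟩
  rw [Finset.card_image_of_injOn hSinj] at hcard'
  let wf : Kˣ × Kˣ × Kˣ → Kˣ := fun q =>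
    if h : (q.2.1 / q.2.2 - q.2.2 / q.2.1 : K) = 0 then 1 else q.1 * Units.mk0 _ h * q.2.2
  obtain ⟨μ, hμ⟩ := π.exists_finitePMF_norm_lt hΓR hdiv hg ((D ×ˢ S ×ˢ S).image wf)
    (show 0 < ε ^ 2 / 2 by positivity)
  have hSne : S.Nonempty := by
    rw [← Finset.card_pos, hcard']; exact_mod_cast hkpos
  refine ⟨S, μ, hSne, hSΓ, fun d hd x n hn => ?_⟩
  let U : R → Kˣ → H := fun c a => π.M (d * n c * a)⁻¹ (π.A ((d * n c * a : Kˣ) : K) g)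
  have hU : ∀ c a, ‖U c a‖ ≤ 1 := fun c a => by
    simp only [U, (π.M _).norm_map, (π.A _).norm_map, hg1]
  have hpair : ∀ a ∈ S, ∀ b ∈ S, μ.avg (fun c => inner ℝ (U c a) (U c b)) ≤
      (if a = b then 1 else 0) + ε ^ 2 / 2 := by
    intro a ha b hb
    split_ifs with hab
    · subst hab
      refine (μ.avg_mono (ψ := fun _ => 1) fun i _ => ?_).trans ?_
      · rw [real_inner_self_eq_norm_sq]
        exact pow_le_one₀ (norm_nonneg _) (hU _ _)
      · rw [μ.avg_const]
        have : 0 < ε ^ 2 / 2 := by positivity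
        linarith
    · have hne : (a / b - b / a : K) ≠ 0 := by
        intro h0
        refine hab (hSinj ha hb ?_)
        have ha0 := a.ne_zero
        have hb0 := b.ne_zero
        field_simp at h0
        rw [mul_zero] at h0
        exact sub_eq_zero.1 h0
      set w : K := d * (a / b - b / a : K) * b with hw
      have hwlt : ‖∑ i ∈ μ.s, μ.wt i • π.A (w * μ.pt i) g‖ < ε ^ 2 / 2 := by
        have := hμ (wf (d, a, b)) (Finset.mem_image_of_mem _ (by simp [hd, ha, hb]))
        simpa [wf, hne, hw] using this
      have heq : μ.avg (fun c => inner ℝ (U c a) (U c b)) = μ.avg (fun c =>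
          inner ℝ (π.A (w * c) g) (π.A (-(w * x)) (π.M b⁻¹ (π.M a g)))) := by
        refine Finset.sum_congr rfl fun i hi => ?_
        simp only [U]
        rw [π.inner_M_inv_A, ← π.inner_A_left, ← π.A_add, Units.val_mul, hn i hi]
        congr 4
        rw [hw]; ring
      rw [heq, μ.avg_inner, zero_add]
      refine (real_inner_le_norm _ _).trans ?_
      rw [(π.A _).norm_map, (π.M _).norm_map, (π.M _).norm_map]
      exact (mul_le_of_le_one_right (norm_nonneg _) hg1).trans hwlt.le
  let X : R → H := fun c => (S.card : ℝ)⁻¹ • ∑ a ∈ S, U c a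
  have hX : ∀ c, (S.card : ℝ)⁻¹ * ∑ a ∈ S,
      inner ℝ (π.A ((d * n c * a : Kˣ) : K) g) (π.M (d * n c * a) f) = inner ℝ (X c) f := by
    intro c
    simp only [X, real_inner_smul_left, sum_inner, U]
    congr 1
    refine Finset.sum_congr rfl fun a _ => ?_
    rw [π.inner_M_left, inv_inv]
  have hXsq : μ.avg (fun c => ‖X c‖ ^ 2) ≤ ε ^ 2 := by
    have h1 : ∀ c, ‖X c‖ ^ 2 = ((S.card : ℝ)⁻¹ ^ 2) *
        ∑ a ∈ S, ∑ b ∈ S, inner ℝ (U c a) (U c b) := by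
      intro c
      rw [← real_inner_self_eq_norm_sq]
      simp only [X, real_inner_smul_left, real_inner_smul_right, sum_inner, inner_sum]
      rw [← Finset.mul_sum, ← mul_assoc, Finset.sum_comm, sq]
    simp only [h1]
    rw [μ.avg_const_mul, μ.avg_sum]
    simp only [μ.avg_sum]
    have h2 : ∑ a ∈ S, ∑ b ∈ S, μ.avg (fun c => inner ℝ (U c a) (U c b)) ≤
        ∑ a ∈ S, ∑ b ∈ S, ((if a = b then 1 else 0) + ε ^ 2 / 2) :=
      Finset.sum_le_sum fun a ha => Finset.sum_le_sum fun b hb => hpair a ha b hb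
    have h3 : ∑ a ∈ S, ∑ b ∈ S, ((if a = b then 1 else 0) + ε ^ 2 / 2) =
        (k : ℝ) + k ^ 2 * (ε ^ 2 / 2) := by
      simp only [Finset.sum_add_distrib, Finset.sum_const, nsmul_eq_mul, hcard',
        Finset.sum_ite_eq]
      simp [hcard']
      ring
    rw [h3] at h2
    rw [hcard']
    refine (mul_le_mul_of_nonneg_left h2 (by positivity)).trans ?_
    have h4 : 2 < k * ε ^ 2 := by
      rwa [div_lt_iff₀ (by positivity)] at hk
    have h5 : (k : ℝ)⁻¹ ^ 2 * (k + k ^ 2 * (ε ^ 2 / 2)) = (k : ℝ)⁻¹ + ε ^ 2 / 2 := by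
      field_simp
    have h6 : (k : ℝ)⁻¹ ≤ ε ^ 2 / 2 := by
      rw [inv_le_iff_one_le_mul₀ hkpos]
      linarith
    linarith
  simp only [hX]
  have h7 : ∀ c, -(ε / 2) + -(1 / (2 * ε)) * ‖X c‖ ^ 2 ≤ inner ℝ (X c) f := by
    intro c
    have h8 := neg_le_of_abs_le (abs_real_inner_le_norm (X c) f)
    have h9 : ‖X c‖ * ‖f‖ ≤ ‖X c‖ := mul_le_of_le_one_right (norm_nonneg _) hf
    have h10 : ‖X c‖ ≤ ε / 2 + 1 / (2 * ε) * ‖X c‖ ^ 2 := by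
      have : ε / 2 + 1 / (2 * ε) * ‖X c‖ ^ 2 - ‖X c‖ = (ε - ‖X c‖) ^ 2 / (2 * ε) := by
        field_simp
        ring
      have h11 : 0 ≤ (ε - ‖X c‖) ^ 2 / (2 * ε) := by positivity
      linarith
    linarith
  refine le_trans ?_ (μ.avg_mono
    (φ := fun c => -(ε / 2) + -(1 / (2 * ε)) * ‖X c‖ ^ 2) fun i _ => h7 (μ.pt i))
  rw [μ.avg_add, μ.avg_const, μ.avg_const_mul]
  have h12 : 1 / (2 * ε) * μ.avg (fun c => ‖X c‖ ^ 2) ≤ 1 / (2 * ε) * ε ^ 2 :=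
    mul_le_mul_of_nonneg_left hXsq (by positivity)
  have h13 : 1 / (2 * ε) * ε ^ 2 = ε / 2 := by field_simp
  linarith

/-- Large intersections: from every `x` one of finitely many affine maps leads to an `n` for which
the correlation of the translation and the dilation by `n` is almost at least the squared mean. -/
theorem exists_large_correlation [CompleteSpace H] {R : Subring K} {Γ : Submonoid Kˣ}
    (hΓR : ∀ p ∈ Γ, (p : K) ∈ R) (hdiv : ∀ k : Kˣ, ∃ p ∈ Γ, ∃ r ∈ R, (p : K) = k * r)
    (hinf : (Γ : Set Kˣ).Infinite) {e f : H} (he : ‖e‖ = 1) (heA : ∀ a, π.A a e = e)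
    (heM : ∀ u, π.M u e = e) (hf : ‖f‖ ≤ 1) {ε : ℝ} (hε : 0 < ε) :
    ∃ (D : Finset Kˣ) (Φ : Finset R), (∀ d ∈ D, d ∈ Γ) ∧
      ∀ x : R, (∀ c ∈ Φ, ∃ n ∈ Γ, (n : K) = x + c) → ∃ d ∈ D, ∃ c ∈ Φ, ∃ n ∈ Γ, (n : K) = x + c ∧
        inner ℝ f e ^ 2 - ε < inner ℝ (π.A ((d * n : Kˣ) : K) f) (π.M (d * n) f) := by
  classical
  have heV : e ∈ π.rat R Γ := π.inv_le_rat Γ.one_mem fun r _ => heA _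
  have hcpl : CompleteSpace (π.rat R Γ) :=
    (Submodule.isClosed_topologicalClosure _).completeSpace_coe
  obtain ⟨v, hv, g, hg, hfvg⟩ := (π.rat R Γ).exists_add_mem_mem_orthogonal f
  have hfv : f - v = g := by rw [hfvg]; abel
  have hg1 : ‖g‖ ≤ 1 := by
    have h1 := norm_add_sq_eq_norm_sq_add_norm_sq_real ((Submodule.mem_orthogonal _ _).1 hg v hv)
    rw [← hfvg] at h1
    nlinarith [norm_nonneg f, norm_nonneg v, norm_nonneg g]
  obtain ⟨u, hu, β, hβ⟩ := π.main_term hΓR he heM heV hf hv (hfv ▸ hg) (show 0 < ε / 4 by positivity)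
  obtain ⟨S, μ, hSne, hSΓ, hS⟩ := π.error_term hΓR hdiv hinf hf hg1 hg
    (β.s.image fun i => (β.pt i : Kˣ) * u) (show 0 < ε / 4 by positivity)
  have hSpos : (0 : ℝ) < S.card := by exact_mod_cast hSne.card_pos
  refine ⟨((β.s.image fun i => (β.pt i : Kˣ) * u) ×ˢ S).image fun q => q.1 * q.2,
    μ.s.image μ.pt, ?_, fun x hx => ?_⟩
  · intro d hd
    simp only [Finset.mem_image, Finset.mem_product, Prod.exists] at hd
    obtain ⟨_, a, ⟨⟨i, -, rfl⟩, ha⟩, rfl⟩ := hd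
    exact Γ.mul_mem (Γ.mul_mem (β.pt i).2 hu) (hSΓ a ha)
  by_contra! hcon
  have hx' : ∀ c : R, ∃ n ∈ Γ, c ∈ μ.s.image μ.pt → (n : K) = x + c := by
    intro c
    by_cases hc : c ∈ μ.s.image μ.pt
    · obtain ⟨n, hn, h⟩ := hx c hc
      exact ⟨n, hn, fun _ => h⟩
    · exact ⟨1, Γ.one_mem, fun h => absurd h hc⟩
  choose n hnΓ hn using hx'
  have hbound : ∀ b ∈ β.s, ∀ i ∈ μ.s, ∀ a ∈ S,
      inner ℝ (π.A (((β.pt b : Kˣ) * u * n (μ.pt i) * a : Kˣ) : K) v)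
        (π.M ((β.pt b : Kˣ) * u * n (μ.pt i) * a) f) +
      inner ℝ (π.A (((β.pt b : Kˣ) * u * n (μ.pt i) * a : Kˣ) : K) g)
        (π.M ((β.pt b : Kˣ) * u * n (μ.pt i) * a) f) ≤ inner ℝ f e ^ 2 - ε := by
    intro b hb i hi a ha
    rw [← inner_add_left, ← map_add, ← hfvg, mul_right_comm]
    refine hcon _ (Finset.mem_image.2 ⟨((β.pt b : Kˣ) * u, a), Finset.mem_product.2
      ⟨Finset.mem_image_of_mem _ hb, ha⟩, rfl⟩) _ (Finset.mem_image_of_mem _ hi) _ (hnΓ _)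
      (hn _ (Finset.mem_image_of_mem _ hi))
  have hsum : β.avg (fun b => μ.avg fun c => (S.card : ℝ)⁻¹ * ∑ a ∈ S,
      (inner ℝ (π.A (((b : Kˣ) * u * n c * a : Kˣ) : K) v) (π.M ((b : Kˣ) * u * n c * a) f) +
      inner ℝ (π.A (((b : Kˣ) * u * n c * a : Kˣ) : K) g) (π.M ((b : Kˣ) * u * n c * a) f))) ≤
      inner ℝ f e ^ 2 - ε := by
    refine (β.avg_mono (ψ := fun _ => inner ℝ f e ^ 2 - ε) fun b hb => ?_).trans_eq (β.avg_const _)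
    refine (μ.avg_mono (ψ := fun _ => inner ℝ f e ^ 2 - ε) fun i hi => ?_).trans_eq (μ.avg_const _)
    rw [inv_mul_le_iff₀ hSpos, ← nsmul_eq_mul]
    exact Finset.sum_le_card_nsmul _ _ _ fun a ha => hbound b hb i hi a ha
  simp only [Finset.sum_add_distrib, mul_add, μ.avg_add, β.avg_add] at hsum
  have hE : -(ε / 4) ≤ β.avg (fun b => μ.avg fun c => (S.card : ℝ)⁻¹ * ∑ a ∈ S,
      inner ℝ (π.A (((b : Kˣ) * u * n c * a : Kˣ) : K) g) (π.M ((b : Kˣ) * u * n c * a) f)) := by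
    rw [← β.avg_const (-(ε / 4))]
    exact β.avg_mono fun b hb => hS _ (Finset.mem_image_of_mem _ hb) x n fun i hi =>
      hn _ (Finset.mem_image_of_mem _ hi)
  have hM : inner ℝ f e ^ 2 - ε / 4 ≤ β.avg (fun b => μ.avg fun c => (S.card : ℝ)⁻¹ * ∑ a ∈ S,
      inner ℝ (π.A (((b : Kˣ) * u * n c * a : Kˣ) : K) v) (π.M ((b : Kˣ) * u * n c * a) f)) := by
    have hswap : β.avg (fun b => μ.avg fun c => (S.card : ℝ)⁻¹ * ∑ a ∈ S,
        inner ℝ (π.A (((b : Kˣ) * u * n c * a : Kˣ) : K) v) (π.M ((b : Kˣ) * u * n c * a) f)) =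
        μ.avg fun c => (S.card : ℝ)⁻¹ * ∑ a ∈ S, β.avg fun b =>
        inner ℝ (π.A (((b : Kˣ) * u * n c * a : Kˣ) : K) v)
          (π.M ((b : Kˣ) * u * n c * a) f) := by
      simp only [← β.avg_sum, ← β.avg_const_mul]
      simp only [FinitePMF.avg, Finset.mul_sum]
      rw [Finset.sum_comm]
      refine Finset.sum_congr rfl fun i _ => Finset.sum_congr rfl fun j _ =>
        Finset.sum_congr rfl fun a _ => by ring
    rw [hswap, ← μ.avg_const (inner ℝ f e ^ 2 - ε / 4)]
    refine μ.avg_mono fun i hi => ?_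
    rw [le_inv_mul_iff₀ hSpos, ← nsmul_eq_mul]
    refine Finset.card_nsmul_le_sum _ _ _ fun a ha => ?_
    have := hβ (n (μ.pt i) * a) (Γ.mul_mem (hnΓ _) (hSΓ a ha))
    simpa only [mul_assoc] using this
  linarith

end AffineRep

/-! ### Existence of double Følner sequences -/

theorem exists_succ_le_mul_of_le_pow (a : ℕ → ℝ) (k : ℕ) (h1 : ∀ N, 1 ≤ a N)
    (hk : ∀ N, a N ≤ ((N : ℝ) + 1) ^ k) {ε : ℝ} (hε : 0 < ε) :
    ∃ N, a (N + 1) ≤ (1 + ε) * a N := by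
  by_contra! hcon
  have hgrow : ∀ N, (1 + ε) ^ N ≤ a N := fun N => by
    induction N with
    | zero => simpa using h1 0
    | succ N ih =>
      rw [pow_succ']
      exact (mul_le_mul_of_nonneg_left ih (by positivity)).trans (hcon N).le
  have hlim := (tendsto_pow_const_div_const_pow_of_one_lt k (show 1 < 1 + ε by linarith)).comp
    (tendsto_add_atTop_nat 1)
  obtain ⟨N, hN⟩ := (hlim.eventually_lt_const (show 0 < 1 / (1 + ε) by positivity)).exists
  simp only [Function.comp_apply, Nat.cast_add, Nat.cast_one] at hN
  rw [div_lt_div_iff₀ (by positivity) (by positivity), one_mul, pow_succ] at hN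
  have h2 := lt_of_mul_lt_mul_right hN (by positivity)
  linarith [hgrow N, hk N]

open scoped Classical in
@[to_additive]
theorem exists_foelner_of_commGroup {G : Type*} [CommGroup G] (U : Finset G) {ε : ℝ}
    (hε : 0 < ε) : ∃ F : Finset G, F.Nonempty ∧
      ∀ u ∈ U, (1 - ε) * F.card ≤ (F ∩ F.image (fun x => x * u)).card := by
  let B : ℕ → Finset G := fun N =>
    (Fintype.piFinset fun _ : U => Finset.range (N + 1)).image fun e => ∏ u : U, (u : G) ^ e u
  have hone : ∀ N, 1 ∈ B N := fun N =>
    Finset.mem_image.2 ⟨fun _ => 0, by simp, by simp⟩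
  have hcard : ∀ N, ((B N).card : ℝ) ≤ ((N : ℝ) + 1) ^ U.card := fun N => by
    refine (Nat.cast_le.2 Finset.card_image_le).trans ?_
    simp [Fintype.card_piFinset]
  have hpos : ∀ N, (1 : ℝ) ≤ (B N).card := fun N => by
    exact_mod_cast Finset.card_pos.2 ⟨1, hone N⟩
  obtain ⟨N, hN⟩ := exists_succ_le_mul_of_le_pow (fun N => ((B N).card : ℝ)) _ hpos hcard hε
  refine ⟨B N, ⟨1, hone N⟩, fun u hu => ?_⟩
  have hsub : B N ∪ (B N).image (fun x => x * u) ⊆ B (N + 1) := by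
    intro x hx
    rcases Finset.mem_union.1 hx with hx | hx
    · obtain ⟨e, he, rfl⟩ := Finset.mem_image.1 hx
      refine Finset.mem_image_of_mem _ (Fintype.mem_piFinset.2 fun i => ?_)
      have := Finset.mem_range.1 (Fintype.mem_piFinset.1 he i)
      exact Finset.mem_range.2 (by omega)
    · obtain ⟨_, hy, rfl⟩ := Finset.mem_image.1 hx
      obtain ⟨e, he, rfl⟩ := Finset.mem_image.1 hy
      refine Finset.mem_image.2 ⟨e + Pi.single ⟨u, hu⟩ 1, Fintype.mem_piFinset.2 fun i => ?_, ?_⟩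
      · have := Finset.mem_range.1 (Fintype.mem_piFinset.1 he i)
        rw [Finset.mem_range, Pi.add_apply, Pi.single_apply]
        split_ifs <;> omega
      · simp only [Pi.add_apply, pow_add, Finset.prod_mul_distrib]
        congr 1
        rw [Finset.prod_eq_single (⟨u, hu⟩ : U)]
        · simp
        · intro b _ hb
          simp [Pi.single_eq_of_ne hb]
        · simp
  have h1 := Finset.card_le_card hsub
  have h2 := Finset.card_union_add_card_inter (B N) ((B N).image fun x => x * u)
  rw [Finset.card_image_of_injective _ (mul_left_injective u)] at h2
  have h3 : ((B N).card : ℝ) + (B N).card ≤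
      (B (N + 1)).card + (B N ∩ (B N).image (fun x => x * u)).card := by
    exact_mod_cast (by omega : (B N).card + (B N).card ≤
      (B (N + 1)).card + (B N ∩ (B N).image (fun x => x * u)).card)
  linarith

open scoped Classical in
theorem exists_finset_almost_affine_invariant {K : Type*} [Field K] [Infinite K] (U : Finset K)
    {ε : ℝ} (hε : 0 < ε) : ∃ F : Finset K, F.Nonempty ∧ ∀ u ∈ U, u ≠ 0 →
      (1 - ε) * F.card ≤ (F ∩ F.image (fun x => x + u)).card ∧
      (1 - ε) * F.card ≤ (F ∩ F.image (fun x => x * u)).card := by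
  obtain ⟨S, hSne, hS⟩ := exists_foelner_of_commGroup
    (U.image fun u => if h : u = 0 then (1 : Kˣ) else Units.mk0 u h) hε
  obtain ⟨A, hAne, hA⟩ := exists_foelner_of_addCommGroup
    ((U ×ˢ S).image fun q : K × Kˣ => q.1 * (q.2⁻¹ : Kˣ)) hε
  obtain ⟨t, ht⟩ := Infinite.exists_notMem_finset
    (((S ×ˢ A) ×ˢ (S ×ˢ A)).image fun q : (Kˣ × K) × (Kˣ × K) =>
      (q.2.1 * q.2.2 - q.1.1 * q.1.2 : K) / (q.1.1 - q.2.1))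
  let φ : Kˣ × K → K := fun q => q.1 * (q.2 + t)
  have hφ : Set.InjOn φ (S ×ˢ A : Finset (Kˣ × K)) := by
    rintro ⟨s, a⟩ h1 ⟨s', a'⟩ h2 h
    simp only [φ] at h
    by_cases hs : s = s'
    · subst hs
      have := mul_left_cancel₀ s.ne_zero h
      rw [add_right_cancel this]
    · have hne : (s - s' : K) ≠ 0 := sub_ne_zero.2 fun h => hs (Units.ext h)
      refine absurd (Finset.mem_image.2 ⟨((s, a), (s', a')), Finset.mem_product.2 ⟨h1, h2⟩, ?_⟩) ht
      rw [div_eq_iff hne]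
      linear_combination -h
  have hcard : ((S ×ˢ A).image φ).card = S.card * A.card := by
    rw [Finset.card_image_of_injOn hφ, Finset.card_product]
  refine ⟨(S ×ˢ A).image φ, (hSne.product hAne).image _, fun u hu hu0 => ⟨?_, ?_⟩⟩
  · let P := (S ×ˢ A).filter fun q : Kˣ × K =>
      q.2 ∈ A.image fun x => x + u * (q.1⁻¹ : Kˣ)
    have hP : P.image φ ⊆ (S ×ˢ A).image φ ∩ ((S ×ˢ A).image φ).image fun x => x + u := by
      intro x hx
      obtain ⟨⟨s, a⟩, hq, rfl⟩ := Finset.mem_image.1 hx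
      obtain ⟨hq1, hq2⟩ := Finset.mem_filter.1 hq
      obtain ⟨a', ha', h⟩ := Finset.mem_image.1 hq2
      refine Finset.mem_inter.2 ⟨Finset.mem_image_of_mem _ hq1, Finset.mem_image.2
        ⟨φ (s, a'), Finset.mem_image_of_mem _
          (Finset.mem_product.2 ⟨(Finset.mem_product.1 hq1).1, ha'⟩), ?_⟩⟩
      simp only [φ] at h ⊢
      rw [← h]
      have hs := s.ne_zero
      push_cast
      field_simp
      ring
    have h1 : (P.image φ).card = P.card := Finset.card_image_of_injOn
      (hφ.mono (Finset.coe_subset.2 (Finset.filter_subset _ _)))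
    have h2 : P.card = ∑ s ∈ S, (A ∩ A.image fun x => x + u * (s⁻¹ : Kˣ)).card := by
      rw [Finset.card_filter, Finset.sum_product]
      refine Finset.sum_congr rfl fun s _ => ?_
      rw [← Finset.card_filter]
      refine congrArg Finset.card (Finset.ext fun a => ?_)
      rw [Finset.mem_filter, Finset.mem_inter]
    have h3 : (1 - ε) * (S.card * A.card) ≤ (P.card : ℝ) := by
      rw [h2, Nat.cast_sum]
      have := Finset.card_nsmul_le_sum S
        (fun s => (((A ∩ A.image fun x => x + u * (s⁻¹ : Kˣ)).card : ℕ) : ℝ)) ((1 - ε) * A.card)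
        fun s hs => hA _ (Finset.mem_image_of_mem (fun q : K × Kˣ => q.1 * ((q.2⁻¹ : Kˣ) : K))
          (Finset.mem_product.2 ⟨hu, hs⟩ : (u, s) ∈ U ×ˢ S))
      rw [nsmul_eq_mul] at this
      linarith
    rw [hcard, Nat.cast_mul]
    refine h3.trans (Nat.cast_le.2 ?_)
    rw [← h1]
    exact Finset.card_le_card hP
  · let w := Units.mk0 u hu0
    have hP : ((S ∩ S.image fun x => x * w) ×ˢ A).image φ ⊆
        (S ×ˢ A).image φ ∩ ((S ×ˢ A).image φ).image fun x => x * u := by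
      intro x hx
      obtain ⟨⟨s, a⟩, hq, rfl⟩ := Finset.mem_image.1 hx
      obtain ⟨hq1, ha⟩ := Finset.mem_product.1 hq
      obtain ⟨hs, hsw⟩ := Finset.mem_inter.1 hq1
      obtain ⟨s', hs', h⟩ := Finset.mem_image.1 hsw
      refine Finset.mem_inter.2 ⟨Finset.mem_image_of_mem _ (Finset.mem_product.2 ⟨hs, ha⟩),
        Finset.mem_image.2 ⟨φ (s', a), Finset.mem_image_of_mem _
          (Finset.mem_product.2 ⟨hs', ha⟩), ?_⟩⟩
      simp only [φ] at h ⊢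
      rw [← h, Units.val_mul, Units.val_mk0]
      ring
    have h1 : (((S ∩ S.image fun x => x * w) ×ˢ A).image φ).card =
        (S ∩ S.image fun x => x * w).card * A.card := by
      rw [Finset.card_image_of_injOn, Finset.card_product]
      exact hφ.mono (Finset.coe_subset.2
        (Finset.product_subset_product_left Finset.inter_subset_left))
    have h2 : (1 - ε) * S.card ≤ ((S ∩ S.image fun x => x * w).card : ℝ) := by
      convert hS w (Finset.mem_image.2 ⟨u, hu, by rw [dif_neg hu0]⟩)
    rw [hcard]
    refine le_trans ?_ (Nat.cast_le.2 (Finset.card_le_card hP))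
    rw [h1, Nat.cast_mul, Nat.cast_mul, ← mul_assoc]
    exact mul_le_mul_of_nonneg_right h2 (Nat.cast_nonneg _)

open scoped Classical in
theorem exists_isDoubleFolner (K : Type*) [Field K] [Infinite K] [Countable K] :
    ∃ F : ℕ → Finset K, IsDoubleFolner F ∧ ∀ N, (F N).Nonempty := by
  obtain ⟨e, he⟩ := exists_surjective_nat K
  have hF := fun N : ℕ => exists_finset_almost_affine_invariant
    ((Finset.range N).image e) (Nat.one_div_pos_of_nat (α := ℝ) (n := N))
  choose F hne hF using hF
  refine ⟨F, fun u hu => ?_, hne⟩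
  obtain ⟨n, rfl⟩ := he u
  have hlim : Tendsto (fun N : ℕ => 1 - 1 / ((N : ℝ) + 1)) atTop (𝓝 1) := by
    simpa using tendsto_one_div_add_atTop_nhds_zero_nat.const_sub (1 : ℝ)
  have key : ∀ φ : K → K,
      (∀ N, n < N → (1 - 1 / ((N : ℝ) + 1)) * (F N).card ≤ (F N ∩ (F N).image φ).card) →
      Tendsto (fun N => ((F N ∩ (F N).image φ).card : ℝ) / ((F N).card : ℝ)) atTop (𝓝 1) := by
    intro φ hφ
    refine tendsto_of_tendsto_of_tendsto_of_le_of_le' hlim tendsto_const_nhds ?_ ?_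
    · filter_upwards [eventually_gt_atTop n] with N hN
      rw [le_div_iff₀ (by exact_mod_cast (hne N).card_pos)]
      exact hφ N hN
    · exact Eventually.of_forall fun N => div_le_one_of_le₀
        (Nat.cast_le.2 (Finset.card_le_card Finset.inter_subset_left)) (Nat.cast_nonneg _)
  have hmem : ∀ N, n < N → e n ∈ (Finset.range N).image e := fun N hN =>
    Finset.mem_image_of_mem _ (Finset.mem_range.2 hN)
  exact ⟨key _ fun N hN => (hF N _ (hmem N hN) hu).1, key _ fun N hN => (hF N _ (hmem N hN) hu).2⟩

open scoped Classical in
/-- One cell of a finite cover has positive upper density. -/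
theorem exists_upperDensity_pos {K : Type*} {F : ℕ → Finset K} (hne : ∀ N, (F N).Nonempty) {r : ℕ}
    {C : Fin r → Set K} (hC : (⋃ i, C i) = Set.univ) : ∃ i, 0 < upperDensity F (C i) := by
  by_contra! hcon
  let d : Fin r → ℕ → ℝ := fun i N => (((F N).filter (fun x => x ∈ C i)).card : ℝ) / (F N).card
  have hd1 : ∀ i N, d i N ≤ 1 := fun i N => div_le_one_of_le₀
    (Nat.cast_le.2 (Finset.card_filter_le _ _)) (Nat.cast_nonneg _)
  have hlim : ∀ i, Tendsto (d i) atTop (𝓝 0) := by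
    intro i
    refine tendsto_order.2 ⟨fun a ha => Eventually.of_forall fun N =>
      lt_of_lt_of_le ha (by positivity), fun a ha => ?_⟩
    exact eventually_lt_of_limsup_lt (lt_of_le_of_lt (hcon i) ha)
      (isBoundedUnder_of ⟨1, hd1 i⟩)
  have hsum : Tendsto (fun N => ∑ i, d i N) atTop (𝓝 0) := by
    simpa using tendsto_finsetSum Finset.univ fun i _ => hlim i
  obtain ⟨N, hN⟩ := (hsum.eventually_lt_const one_pos).exists
  have hcard : (F N).card ≤ ∑ i, ((F N).filter (fun x => x ∈ C i)).card := by
    refine le_trans (Finset.card_le_card fun x hx => ?_) Finset.card_biUnion_le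
    obtain ⟨i, hi⟩ := Set.mem_iUnion.1 (hC ▸ Set.mem_univ x : x ∈ ⋃ i, C i)
    exact Finset.mem_biUnion.2 ⟨i, Finset.mem_univ _, Finset.mem_filter.2 ⟨hx, hi⟩⟩
  have hpos : (0 : ℝ) < (F N).card := by exact_mod_cast (hne N).card_pos
  simp only [d, ← Finset.sum_div] at hN
  rw [div_lt_one hpos] at hN
  have : ((F N).card : ℝ) ≤ ∑ i, (((F N).filter (fun x => x ∈ C i)).card : ℝ) := by
    exact_mod_cast hcard
  linarith

noncomputable section

/-! ### Hilbert space completions -/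

theorem exists_hilbert_completion.{u} {E : Type u} [AddCommGroup E] [Module ℝ E]
    (c : PreInnerProductSpace.Core ℝ E) :
    ∃ (H : Type u) (_ : NormedAddCommGroup H) (_ : InnerProductSpace ℝ H) (_ : CompleteSpace H)
      (ι : E →ₗ[ℝ] H), DenseRange ι ∧ ∀ x y, inner ℝ (ι x) (ι y) = c.inner x y := by
  let : SeminormedAddCommGroup E := InnerProductSpace.Core.toSeminormedAddCommGroup (c := c)
  let : InnerProductSpace ℝ E := InnerProductSpace.ofCore c
  refine ⟨UniformSpace.Completion E, inferInstance, inferInstance, inferInstance,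
    (UniformSpace.Completion.toComplₗᵢ (𝕜 := ℝ) (E := E)).toLinearMap,
    UniformSpace.Completion.denseRange_coe, fun x y => ?_⟩
  exact UniformSpace.Completion.inner_coe x y

theorem exists_linearIsometry_extension {E H : Type*} [AddCommGroup E] [Module ℝ E]
    [NormedAddCommGroup H] [InnerProductSpace ℝ H] [CompleteSpace H] {ι : E →ₗ[ℝ] H}
    (hι : DenseRange ι) (T : E →ₗ[ℝ] E) (hT : ∀ x, ‖ι (T x)‖ = ‖ι x‖) :
    ∃ T' : H →ₗᵢ[ℝ] H, ∀ x, T' (ι x) = ι (T x) := by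
  have h := LinearMap.extendOfNorm_eq (f := ι ∘ₗ T) (e := ι) hι ⟨1, fun x => by simp [hT]⟩
  refine ⟨⟨((ι ∘ₗ T).extendOfNorm ι).toLinearMap, fun x => ?_⟩, h⟩
  refine hι.induction_on (p := fun x => ‖(ι ∘ₗ T).extendOfNorm ι x‖ = ‖x‖) x
    (isClosed_eq (by fun_prop) continuous_norm) fun x => ?_
  rw [h, LinearMap.comp_apply, hT]

/-! ### Means along double Følner sequences -/

/-- The space of bounded real functions. -/
def boundedFunctions (K : Type*) : Submodule ℝ (K → ℝ) where
  carrier := {h | ∃ B, ∀ x, |h x| ≤ B}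
  add_mem' := by
    rintro f g ⟨a, ha⟩ ⟨b, hb⟩
    exact ⟨a + b, fun x => (abs_add_le _ _).trans (add_le_add (ha x) (hb x))⟩
  zero_mem' := ⟨0, fun x => by simp⟩
  smul_mem' := by
    rintro c f ⟨a, ha⟩
    refine ⟨|c| * a, fun x => ?_⟩
    rw [Pi.smul_apply, smul_eq_mul, abs_mul]
    exact mul_le_mul_of_nonneg_left (ha x) (abs_nonneg _)

theorem mul_mem_boundedFunctions {K : Type*} {f g : K → ℝ} (hf : f ∈ boundedFunctions K)
    (hg : g ∈ boundedFunctions K) : f * g ∈ boundedFunctions K := by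
  obtain ⟨a, ha⟩ := hf
  obtain ⟨b, hb⟩ := hg
  refine ⟨a * b, fun x => ?_⟩
  rw [Pi.mul_apply, abs_mul]
  exact mul_le_mul (ha x) (hb x) (abs_nonneg _) ((abs_nonneg _).trans (ha x))

theorem comp_mem_boundedFunctions {K : Type*} {f : K → ℝ} (hf : f ∈ boundedFunctions K)
    (σ : K → K) : f ∘ σ ∈ boundedFunctions K := by
  obtain ⟨a, ha⟩ := hf
  exact ⟨a, fun x => ha _⟩

/-- The average of `h` over a finite set. -/
def finsetAvg {K : Type*} (F : Finset K) (h : K → ℝ) : ℝ := (∑ x ∈ F, h x) / F.card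

/-- The limit along an ultrafilter of the averages over the sets of a sequence. -/
def ultraMean {K : Type*} (𝒰 : Ultrafilter ℕ) (F : ℕ → Finset K) (h : K → ℝ) : ℝ :=
  limUnder (𝒰 : Filter ℕ) fun N => finsetAvg (F N) h

section ultraMean

variable {K : Type*} (𝒰 : Ultrafilter ℕ) (F : ℕ → Finset K)

theorem abs_finsetAvg_le {h : K → ℝ} {B : ℝ} (hB0 : 0 ≤ B) (hB : ∀ x, |h x| ≤ B) (S : Finset K) :
    |finsetAvg S h| ≤ B := by
  rw [finsetAvg, abs_div, Nat.abs_cast]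
  refine div_le_of_le_mul₀ (Nat.cast_nonneg _) hB0 ((Finset.abs_sum_le_sum_abs _ _).trans ?_)
  rw [mul_comm, ← nsmul_eq_mul]
  exact Finset.sum_le_card_nsmul _ _ _ fun x _ => hB x

theorem tendsto_ultraMean {h : K → ℝ} (hh : h ∈ boundedFunctions K) :
    Tendsto (fun N => finsetAvg (F N) h) 𝒰 (𝓝 (ultraMean 𝒰 F h)) := by
  obtain ⟨B, hB⟩ := hh
  have hmem : ∀ N, finsetAvg (F N) h ∈ Set.Icc (-|B|) |B| := fun N =>
    abs_le.1 (abs_finsetAvg_le (abs_nonneg _) (fun x => (hB x).trans (le_abs_self _)) _)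
  obtain ⟨a, -, ha⟩ := isCompact_Icc.ultrafilter_le_nhds'
    (𝒰.map fun N => finsetAvg (F N) h) (Eventually.of_forall (f := (𝒰 : Filter ℕ)) hmem)
  exact tendsto_nhds_limUnder ⟨a, ha⟩

theorem ultraMean_add {f g : K → ℝ} (hf : f ∈ boundedFunctions K) (hg : g ∈ boundedFunctions K) :
    ultraMean 𝒰 F (f + g) = ultraMean 𝒰 F f + ultraMean 𝒰 F g := by
  refine tendsto_nhds_unique (tendsto_ultraMean 𝒰 F (Submodule.add_mem _ hf hg)) ?_
  refine ((tendsto_ultraMean 𝒰 F hf).add (tendsto_ultraMean 𝒰 F hg)).congr fun N => ?_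
  simp only [finsetAvg, Pi.add_apply, Finset.sum_add_distrib, add_div]

theorem ultraMean_smul (c : ℝ) {f : K → ℝ} (hf : f ∈ boundedFunctions K) :
    ultraMean 𝒰 F (c • f) = c * ultraMean 𝒰 F f := by
  refine tendsto_nhds_unique (tendsto_ultraMean 𝒰 F (Submodule.smul_mem _ c hf)) ?_
  refine ((tendsto_ultraMean 𝒰 F hf).const_mul c).congr fun N => ?_
  simp only [finsetAvg, Pi.smul_apply, smul_eq_mul, ← Finset.mul_sum, mul_div_assoc]

theorem ultraMean_nonneg {f : K → ℝ} (hf : f ∈ boundedFunctions K) (h0 : ∀ x, 0 ≤ f x) :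
    0 ≤ ultraMean 𝒰 F f :=
  ge_of_tendsto' (tendsto_ultraMean 𝒰 F hf) fun _ =>
    div_nonneg (Finset.sum_nonneg fun x _ => h0 x) (Nat.cast_nonneg _)

open scoped Classical in
theorem abs_sum_comp_sub_sum_le {h : K → ℝ} {B : ℝ} (hB : ∀ x, |h x| ≤ B) (S : Finset K)
    {σ : K → K} (hσ : σ.Injective) :
    |∑ x ∈ S, h (σ x) - ∑ x ∈ S, h x| ≤ 2 * B * (S.card - (S ∩ S.image σ).card) := by
  have h1 : ∑ x ∈ S, h (σ x) = ∑ x ∈ S.image σ, h x :=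
    (Finset.sum_image fun x _ y _ hxy => hσ hxy).symm
  have h2 := Finset.sum_inter_add_sum_sdiff S (S.image σ) h
  have h3 := Finset.sum_inter_add_sum_sdiff (S.image σ) S h
  have c1 : ((S \ S.image σ).card : ℝ) = S.card - (S ∩ S.image σ).card := by
    rw [eq_sub_iff_add_eq]
    exact_mod_cast Finset.card_sdiff_add_card_inter S (S.image σ)
  have c2 : ((S.image σ \ S).card : ℝ) = S.card - (S ∩ S.image σ).card := by
    rw [eq_sub_iff_add_eq, Finset.inter_comm]
    have := Finset.card_sdiff_add_card_inter (S.image σ) S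
    rw [Finset.card_image_of_injective _ hσ] at this
    exact_mod_cast this
  have bd : ∀ T : Finset K, |∑ x ∈ T, h x| ≤ T.card * B := fun T => by
    refine (Finset.abs_sum_le_sum_abs _ _).trans ?_
    rw [← nsmul_eq_mul]
    exact Finset.sum_le_card_nsmul _ _ _ fun x _ => hB x
  have b1 := bd (S \ S.image σ)
  have b2 := bd (S.image σ \ S)
  rw [c1] at b1
  rw [c2] at b2
  rw [h1, ← h2, ← h3, Finset.inter_comm, add_sub_add_left_eq_sub]
  refine (abs_sub _ _).trans ?_
  linarith

open scoped Classical in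
theorem ultraMean_comp (h𝒰 : (𝒰 : Filter ℕ) ≤ atTop) {σ : K → K} (hσ : σ.Injective)
    (hF : Tendsto (fun N => ((F N ∩ (F N).image σ).card : ℝ) / ((F N).card : ℝ)) atTop (𝓝 1))
    {h : K → ℝ} (hh : h ∈ boundedFunctions K) :
    ultraMean 𝒰 F (h ∘ σ) = ultraMean 𝒰 F h := by
  obtain ⟨B, hB⟩ := id hh
  rw [← sub_eq_zero]
  refine tendsto_nhds_unique ((tendsto_ultraMean 𝒰 F (comp_mem_boundedFunctions hh σ)).sub
    (tendsto_ultraMean 𝒰 F hh)) ?_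
  have hlim : Tendsto (fun N => 2 * B * (1 - ((F N ∩ (F N).image σ).card : ℝ) / (F N).card))
      𝒰 (𝓝 0) := by
    simpa using ((hF.mono_left h𝒰).const_sub 1).const_mul (2 * B)
  have hpos : ∀ᶠ N in (𝒰 : Filter ℕ),
      0 < ((F N ∩ (F N).image σ).card : ℝ) / ((F N).card : ℝ) :=
    (hF.mono_left h𝒰).eventually_const_lt one_pos
  refine squeeze_zero_norm' ?_ hlim
  filter_upwards [hpos] with N hN
  have hc : (0 : ℝ) < (F N).card := by
    refine lt_of_le_of_ne (Nat.cast_nonneg _) fun h0 => ?_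
    rw [← h0, div_zero] at hN
    exact lt_irrefl _ hN
  rw [Real.norm_eq_abs, finsetAvg, finsetAvg, ← sub_div, abs_div, abs_of_pos hc, div_le_iff₀ hc]
  refine (abs_sum_comp_sub_sum_le hB (F N) hσ).trans_eq ?_
  field_simp

end ultraMean

theorem exists_affineRep.{u} {K : Type u} [Field K] {F : ℕ → Finset K} (hF : IsDoubleFolner F)
    {𝒰 : Ultrafilter ℕ} (h𝒰 : (𝒰 : Filter ℕ) ≤ atTop) :
    ∃ (H : Type u) (_ : NormedAddCommGroup H) (_ : InnerProductSpace ℝ H) (_ : CompleteSpace H)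
      (ι : boundedFunctions K →ₗ[ℝ] H) (π : AffineRep K H),
      (∀ f g, inner ℝ (ι f) (ι g) = ultraMean 𝒰 F (f * g : K → ℝ)) ∧
      (∀ v f, π.A v (ι f) = ι ⟨_, comp_mem_boundedFunctions f.2 fun x => x + v⟩) ∧
      (∀ u f, π.M u (ι f) = ι ⟨_, comp_mem_boundedFunctions f.2 fun x => x * (u : Kˣ)⟩) := by
  let c : PreInnerProductSpace.Core ℝ (boundedFunctions K) :=
    { inner := fun f g => ultraMean 𝒰 F (f * g : K → ℝ)
      conj_inner_symm := fun f g => by simp [mul_comm]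
      re_inner_nonneg := fun f => ultraMean_nonneg 𝒰 F (mul_mem_boundedFunctions f.2 f.2)
        fun x => mul_self_nonneg _
      add_left := fun f g h => by
        rw [Submodule.coe_add, add_mul]
        exact ultraMean_add 𝒰 F (mul_mem_boundedFunctions f.2 h.2)
          (mul_mem_boundedFunctions g.2 h.2)
      smul_left := fun f g r => by
        rw [Submodule.coe_smul, smul_mul_assoc]
        exact ultraMean_smul 𝒰 F r (mul_mem_boundedFunctions f.2 g.2) }
  obtain ⟨H, i1, i2, i3, ι, hι, hinner⟩ := exists_hilbert_completion c
  have hcomp : ∀ σ : K → K, (∀ h ∈ boundedFunctions K, ultraMean 𝒰 F (h ∘ σ) = ultraMean 𝒰 F h) →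
      ∃ T : H →ₗᵢ[ℝ] H, ∀ f, T (ι f) = ι ⟨_, comp_mem_boundedFunctions f.2 σ⟩ := by
    intro σ hσ
    refine exists_linearIsometry_extension hι
      { toFun := fun f => ⟨_, comp_mem_boundedFunctions f.2 σ⟩
        map_add' := fun f g => rfl
        map_smul' := fun r f => rfl } fun f => ?_
    have h1 := hσ _ (mul_mem_boundedFunctions f.2 f.2)
    rw [← sq_eq_sq₀ (norm_nonneg _) (norm_nonneg _), ← real_inner_self_eq_norm_sq,
      ← real_inner_self_eq_norm_sq, hinner, hinner]
    exact h1
  have hA : ∀ v : K, ∃ T : H →ₗᵢ[ℝ] H,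
      ∀ f, T (ι f) = ι ⟨_, comp_mem_boundedFunctions f.2 fun x => x + v⟩ := by
    intro v
    refine hcomp _ fun h hh => ?_
    by_cases hv : v = 0
    · subst hv
      congr 1
      ext x
      simp
    · exact ultraMean_comp 𝒰 F h𝒰 (add_left_injective v) (hF v hv).1 hh
  have hM : ∀ u : Kˣ, ∃ T : H →ₗᵢ[ℝ] H,
      ∀ f, T (ι f) = ι ⟨_, comp_mem_boundedFunctions f.2 fun x => x * (u : Kˣ)⟩ := fun u =>
    hcomp _ fun h hh => ultraMean_comp 𝒰 F h𝒰 (mul_left_injective₀ u.ne_zero) (hF u u.ne_zero).2 hh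
  choose A hA using hA
  choose M hM using hM
  refine ⟨H, i1, i2, i3, ι, ⟨A, M, ?_, ?_, ?_, ?_, ?_⟩, hinner, hA, hM⟩
  · intro x
    refine hι.induction_on (p := fun x => A 0 x = x) x
      (isClosed_eq (A 0).continuous continuous_id) fun f => ?_
    rw [hA]
    congr 2
    ext x
    simp
  · intro v w x
    refine hι.induction_on (p := fun x => A (v + w) x = A v (A w x)) x
      (isClosed_eq (A _).continuous ((A _).continuous.comp (A _).continuous)) fun f => ?_
    rw [hA, hA, hA]
    congr 2
    ext x
    simp [add_assoc]
  · intro x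
    refine hι.induction_on (p := fun x => M 1 x = x) x
      (isClosed_eq (M 1).continuous continuous_id) fun f => ?_
    rw [hM]
    congr 2
    ext x
    simp
  · intro v w x
    refine hι.induction_on (p := fun x => M (v * w) x = M v (M w x)) x
      (isClosed_eq (M _).continuous ((M _).continuous.comp (M _).continuous)) fun f => ?_
    rw [hM, hM, hM]
    congr 2
    ext x
    simp [mul_assoc]
  · intro v u x
    refine hι.induction_on (p := fun x => A v (M u x) = M u (A (v * u) x)) x
      (isClosed_eq ((A _).continuous.comp (M _).continuous)
        ((M _).continuous.comp (A _).continuous)) fun f => ?_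
    rw [hM, hA, hA, hM]
    congr 2
    ext x
    simp [add_mul]

section upperDensity

open scoped Classical

variable {K : Type*} {F : ℕ → Finset K}

theorem finsetAvg_indicator (S : Finset K) (C : Set K) :
    finsetAvg S (C.indicator 1) = ((S.filter (fun x => x ∈ C)).card : ℝ) / (S.card : ℝ) := by
  simp [finsetAvg, Set.indicator_apply]

theorem indicator_mem_boundedFunctions (C : Set K) : C.indicator 1 ∈ boundedFunctions K :=
  ⟨1, fun x => by by_cases h : x ∈ C <;> simp [h]⟩

theorem finsetAvg_indicator_le_one (S : Finset K) (C : Set K) :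
    finsetAvg S (C.indicator 1) ≤ 1 := by
  rw [finsetAvg_indicator]
  exact div_le_one_of_le₀ (Nat.cast_le.2 (Finset.card_filter_le _ _)) (Nat.cast_nonneg _)

theorem finsetAvg_indicator_nonneg (S : Finset K) (C : Set K) :
    0 ≤ finsetAvg S (C.indicator 1) := by
  rw [finsetAvg_indicator]
  positivity

theorem upperDensity_eq_limsup (F : ℕ → Finset K) (C : Set K) :
    upperDensity F C = limsup (fun N => finsetAvg (F N) (C.indicator 1)) atTop := by
  simp only [upperDensity, finsetAvg_indicator]

theorem upperDensity_le_one (F : ℕ → Finset K) (C : Set K) : upperDensity F C ≤ 1 := by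
  rw [upperDensity_eq_limsup]
  exact limsup_le_of_le (isCoboundedUnder_le_of_le atTop fun N => finsetAvg_indicator_nonneg _ _)
    (Eventually.of_forall fun N => finsetAvg_indicator_le_one _ _)

theorem ultraMean_indicator_le_upperDensity {𝒰 : Ultrafilter ℕ} (h𝒰 : (𝒰 : Filter ℕ) ≤ atTop)
    (C : Set K) : ultraMean 𝒰 F (C.indicator 1) ≤ upperDensity F C := by
  refine le_of_forall_gt fun a ha => ?_
  rw [upperDensity_eq_limsup] at ha
  obtain ⟨b, hb, hba⟩ := exists_between ha
  have h := eventually_lt_of_limsup_lt hb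
    (isBoundedUnder_of ⟨1, fun N => finsetAvg_indicator_le_one (F N) C⟩)
  exact lt_of_le_of_lt (le_of_tendsto (tendsto_ultraMean 𝒰 F (indicator_mem_boundedFunctions C))
    ((h.filter_mono h𝒰).mono fun N hN => le_of_lt hN)) hba

theorem exists_ultrafilter_le_ultraMean (F : ℕ → Finset K) (C : Set K) {a : ℝ}
    (ha : a < upperDensity F C) :
    ∃ 𝒰 : Ultrafilter ℕ, (𝒰 : Filter ℕ) ≤ atTop ∧ a ≤ ultraMean 𝒰 F (C.indicator 1) := by
  rw [upperDensity_eq_limsup] at ha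
  have hfr := frequently_lt_of_lt_limsup
    (isCoboundedUnder_le_of_le atTop fun N => finsetAvg_indicator_nonneg (F N) C) ha
  have : NeBot (atTop ⊓ 𝓟 {N | a < finsetAvg (F N) (C.indicator 1)}) :=
    frequently_mem_iff_neBot.1 hfr
  refine ⟨Ultrafilter.of (atTop ⊓ 𝓟 {N | a < finsetAvg (F N) (C.indicator 1)}),
    (Ultrafilter.of_le _).trans inf_le_left, ?_⟩
  refine ge_of_tendsto (tendsto_ultraMean _ F (indicator_mem_boundedFunctions C)) ?_
  exact (Eventually.filter_mono ((Ultrafilter.of_le _).trans inf_le_right)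
    (eventually_principal.2 fun N hN => hN)).mono fun N hN => le_of_lt hN

/-- Combinatorial form of `AffineRep.exists_large_correlation`. -/
theorem exists_large_upperDensity [Field K] (hF : IsDoubleFolner F) {R : Subring K}
    {Γ : Submonoid Kˣ} (hΓR : ∀ p ∈ Γ, (p : K) ∈ R)
    (hdiv : ∀ k : Kˣ, ∃ p ∈ Γ, ∃ r ∈ R, (p : K) = k * r) (hinf : (Γ : Set Kˣ).Infinite)
    {C : Set K} (hC : 0 < upperDensity F C) {ε : ℝ} (hε : 0 < ε) :
    ∃ (D : Finset Kˣ) (Φ : Finset R), (∀ d ∈ D, d ∈ Γ) ∧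
      ∀ x : R, (∀ c ∈ Φ, ∃ n ∈ Γ, (n : K) = x + c) → ∃ d ∈ D, ∃ c ∈ Φ, ∃ n ∈ Γ, (n : K) = x + c ∧
        upperDensity F C ^ 2 - ε < upperDensity F {y : K | y + d * n ∈ C ∧ y * (d * n) ∈ C} := by
  set D₀ := upperDensity F C with hD₀
  have hD1 : D₀ ≤ 1 := upperDensity_le_one F C
  set δ := min (ε / 4) (D₀ / 2) with hδ
  have hδ0 : 0 < δ := lt_min (by positivity) (by positivity)
  have hδ1 : δ ≤ ε / 4 := min_le_left _ _
  have hδ2 : δ ≤ D₀ / 2 := min_le_right _ _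
  obtain ⟨𝒰, h𝒰, hmean⟩ := exists_ultrafilter_le_ultraMean F C (show D₀ - δ < D₀ by linarith)
  obtain ⟨H, i1, i2, i3, ι, π, hinner, hA, hM⟩ := exists_affineRep hF h𝒰
  let f : boundedFunctions K := ⟨_, indicator_mem_boundedFunctions C⟩
  let e : boundedFunctions K := ⟨_, indicator_mem_boundedFunctions Set.univ⟩
  have hone : ultraMean 𝒰 F 1 = 1 := by
    refine tendsto_nhds_unique (tendsto_ultraMean 𝒰 F (h := 1) ⟨1, fun x => by simp⟩) ?_
    refine tendsto_const_nhds.congr' ?_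
    have := ((hF 1 one_ne_zero).1.mono_left h𝒰).eventually_const_lt one_pos
    filter_upwards [this] with N hN
    have hc : ((F N).card : ℝ) ≠ 0 := fun h0 => by
      rw [h0, div_zero] at hN
      exact lt_irrefl _ hN
    simp [finsetAvg, hc]
  have he : ‖ι e‖ = 1 := by
    rw [← sq_eq_sq₀ (norm_nonneg _) zero_le_one, ← real_inner_self_eq_norm_sq, hinner]
    simp [e, hone]
  have hfe : inner ℝ (ι f) (ι e) = ultraMean 𝒰 F (C.indicator 1) := by
    rw [hinner]
    simp [e, f]
  have hf : ‖ι f‖ ≤ 1 := by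
    rw [← sq_le_one_iff₀ (norm_nonneg _), ← real_inner_self_eq_norm_sq, hinner]
    have : (f * f : K → ℝ) = C.indicator 1 := by
      ext x
      by_cases h : x ∈ C <;> simp [f, h]
    rw [this]
    exact (ultraMean_indicator_le_upperDensity h𝒰 C).trans hD1
  obtain ⟨D, Φ, hDΓ, hmain⟩ := π.exists_large_correlation hΓR hdiv hinf he
    (fun a => by rw [hA]; rfl) (fun u => by rw [hM]; rfl) hf (show 0 < ε / 2 by positivity)
  refine ⟨D, Φ, hDΓ, fun x hx => ?_⟩
  obtain ⟨d, hd, c, hc, n, hn, hnx, hlt⟩ := hmain x hx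
  refine ⟨d, hd, c, hc, n, hn, hnx, ?_⟩
  refine lt_of_lt_of_le ?_ (ultraMean_indicator_le_upperDensity h𝒰 _)
  rw [hfe, hA, hM, hinner] at hlt
  have heq : ((fun x => f.1 (x + (d * n : Kˣ))) * (fun x => f.1 (x * (d * n : Kˣ))) : K → ℝ) =
      Set.indicator {y : K | y + d * n ∈ C ∧ y * (d * n) ∈ C} 1 := by
    ext y
    by_cases h1 : y + d * n ∈ C <;> by_cases h2 : y * (d * n) ∈ C <;>
      simp [f, Set.indicator_apply, h1, h2]
  have hlt' : ultraMean 𝒰 F (C.indicator 1) ^ 2 - ε / 2 <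
      ultraMean 𝒰 F (Set.indicator {y : K | y + d * n ∈ C ∧ y * (d * n) ∈ C} 1) := by
    rw [← heq]
    exact hlt
  have hsq : (D₀ - δ) ^ 2 ≤ ultraMean 𝒰 F (C.indicator 1) ^ 2 :=
    pow_le_pow_left₀ (by linarith) hmean 2
  nlinarith

end upperDensity

end

/-! ### Fields of fractions and affine syndeticity -/

section fractionRing

open scoped Classical

variable {R K : Type*} [CommRing R] [IsDomain R] [Field K] [Algebra R K] [IsFractionRing R K]

/-- `exists_large_upperDensity` for the pairs `{y + n, y n}` with `n` in a domain `R` whose field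
of fractions is `K`. -/
theorem exists_large_upperDensity_pairBases {F : ℕ → Finset K} (hF : IsDoubleFolner F)
    {Γ : Submonoid R} (h0 : (0 : R) ∉ Γ) (hdvd : ∀ r : R, r ≠ 0 → ∃ p ∈ Γ, r ∣ p)
    (hinf : (Γ : Set R).Infinite) {C : Set K} (hC : 0 < upperDensity F C) {ε : ℝ} (hε : 0 < ε) :
    ∃ D Φ : Finset R, (∀ d ∈ D, d ∈ Γ) ∧ ∀ x : R, (∀ c ∈ Φ, x + c ∈ Γ) →
      ∃ d ∈ D, ∃ c ∈ Φ,
        upperDensity F C ^ 2 - ε < upperDensity F (pairBases C (d * (x + c))) := by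
  have hinj : Function.Injective (algebraMap R K) := IsFractionRing.injective R K
  have hne : ∀ p ∈ Γ, algebraMap R K p ≠ 0 := fun p hp h =>
    h0 ((map_eq_zero_iff _ hinj).1 h ▸ hp)
  let Γ' : Submonoid Kˣ := (Γ.map (algebraMap R K)).comap (Units.coeHom K)
  have hmem : ∀ u : Kˣ, u ∈ Γ' ↔ ∃ p ∈ Γ, algebraMap R K p = u := fun u => Iff.rfl
  have hΓR : ∀ u ∈ Γ', (u : K) ∈ (algebraMap R K).range := fun u hu => by
    obtain ⟨p, -, h⟩ := (hmem u).1 hu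
    exact ⟨p, h⟩
  have hdiv : ∀ k : Kˣ, ∃ p ∈ Γ', ∃ r ∈ (algebraMap R K).range, (p : K) = k * r := by
    intro k
    obtain ⟨a, b, hb, hab⟩ := IsFractionRing.div_surjective (A := R) (k : K)
    have hb' : algebraMap R K b ≠ 0 := fun h =>
      nonZeroDivisors.ne_zero hb ((map_eq_zero_iff _ hinj).1 h)
    have ha : a ≠ 0 := by
      rintro rfl
      rw [map_zero, zero_div] at hab
      exact k.ne_zero hab.symm
    obtain ⟨_, hp, s, rfl⟩ := hdvd a ha
    refine ⟨Units.mk0 _ (hne _ hp), (hmem _).2 ⟨_, hp, rfl⟩, _, ⟨b * s, rfl⟩, ?_⟩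
    rw [← hab, Units.val_mk0, map_mul, map_mul]
    field_simp
  have hinf' : (Γ' : Set Kˣ).Infinite := by
    intro hfin
    refine hinf (((hfin.image (Units.val : Kˣ → K)).preimage hinj.injOn).subset fun p hp => ?_)
    exact ⟨Units.mk0 _ (hne p hp), (hmem _).2 ⟨p, hp, rfl⟩, rfl⟩
  obtain ⟨D, Φ, hD, hmain⟩ := exists_large_upperDensity hF hΓR hdiv hinf' hC hε
  choose! q hqΓ hq using fun u (hu : u ∈ Γ') => (hmem u).1 hu
  choose g hg using fun c : (algebraMap R K).range => c.2
  refine ⟨D.image q, Φ.image g, ?_, fun x hx => ?_⟩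
  · intro d hd
    obtain ⟨u, hu, rfl⟩ := Finset.mem_image.1 hd
    exact hqΓ u (hD u hu)
  · obtain ⟨d, hd, c, hc, n, -, hnx, hlt⟩ := hmain ⟨algebraMap R K x, x, rfl⟩ fun c hc => by
      have h := hx _ (Finset.mem_image_of_mem g hc)
      exact ⟨Units.mk0 _ (hne _ h), (hmem _).2 ⟨_, h, rfl⟩, by simp [hg]⟩
    refine ⟨_, Finset.mem_image_of_mem q hd, _, Finset.mem_image_of_mem g hc, ?_⟩
    have heq : algebraMap R K (q d * (x + g c)) = d * n := by
      rw [map_mul, map_add, hq d (hD d hd), hg, hnx]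
    have hset : pairBases C (q d * (x + g c)) = {y : K | y + d * n ∈ C ∧ y * (d * n) ∈ C} := by
      ext y
      simp [pairBases, heq, Set.insert_subset_iff]
    rw [hset]
    exact hlt

end fractionRing

theorem isAffinelySyndetic_of_forall_exists {R : Type*} [CommRing R] [IsDomain R] {S : Set R}
    (P : R → Prop) {D Φ : Finset R} (hD : ∀ d ∈ D, d ≠ 0)
    (hS : ∀ x, (∀ c ∈ Φ, P (x + c)) → ∃ d ∈ D, ∃ c ∈ Φ, d * (x + c) ∈ S)
    (G : Finset (R × R)) (hG : ∀ g ∈ G, g.1 ≠ 0)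
    (hP : ∀ x, ∃ g ∈ G, ∀ c ∈ Φ, P (g.1 * x + g.2 + c)) : IsAffinelySyndetic S := by
  classical
  refine ⟨(D ×ˢ Φ ×ˢ G).image fun q => (q.1 * q.2.2.1, q.1 * (q.2.2.2 + q.2.1)), ?_, fun x => ?_⟩
  · intro g hg
    obtain ⟨⟨d, c, g⟩, hq, rfl⟩ := Finset.mem_image.1 hg
    simp only [Finset.mem_product] at hq
    exact mul_ne_zero (hD d hq.1) (hG g hq.2.2)
  · obtain ⟨g, hg, h⟩ := hP x
    obtain ⟨d, hd, c, hc, hmem⟩ := hS _ h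
    refine ⟨_, Finset.mem_image_of_mem _ (by simp [hd, hc, hg] : (d, c, g) ∈ D ×ˢ Φ ×ˢ G), ?_⟩
    convert hmem using 1
    ring

theorem exists_finset_translates_ne_zero {R : Type*} [CommRing R] [IsDomain R] [Infinite R]
    (Φ : Finset R) : ∃ G : Finset (R × R), (∀ g ∈ G, g.1 ≠ 0) ∧
      ∀ x, ∃ g ∈ G, ∀ c ∈ Φ, g.1 * x + g.2 + c ≠ 0 := by
  classical
  obtain ⟨T, hT⟩ := Infinite.exists_subset_card_eq R (Φ.card + 1)
  refine ⟨T.image fun s => (1, s), ?_, fun x => ?_⟩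
  · intro g hg
    obtain ⟨s, -, rfl⟩ := Finset.mem_image.1 hg
    exact one_ne_zero
  · have hcard := Finset.card_image_le (s := Φ) (f := fun c => -x - c)
    obtain ⟨s, hs, hs'⟩ := Finset.exists_mem_notMem_of_card_lt_card
      (show (Φ.image fun c => -x - c).card < T.card by omega)
    refine ⟨(1, s), Finset.mem_image_of_mem _ hs, fun c hc h => hs' ?_⟩
    refine Finset.mem_image.2 ⟨c, hc, ?_⟩
    linear_combination -h

theorem exists_finset_affine_pos (Φ : Finset ℤ) : ∃ G : Finset (ℤ × ℤ), (∀ g ∈ G, g.1 ≠ 0) ∧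
    ∀ x, ∃ g ∈ G, ∀ c ∈ Φ, 0 < g.1 * x + g.2 + c := by
  have hN : ∀ c ∈ Φ, 0 < (1 + ∑ c ∈ Φ, |c|) + c := fun c hc => by
    have h1 := Finset.single_le_sum (f := fun c : ℤ => |c|) (fun c _ => abs_nonneg c) hc
    have h2 := neg_abs_le c
    omega
  refine ⟨{(1, 1 + ∑ c ∈ Φ, |c|), (-1, 1 + ∑ c ∈ Φ, |c|)}, by simp, fun x => ?_⟩
  rcases le_total 0 x with hx | hx
  · refine ⟨_, Finset.mem_insert_self _ _, fun c hc => ?_⟩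
    have := hN c hc
    simp only
    omega
  · refine ⟨_, Finset.mem_insert_of_mem (Finset.mem_singleton_self _), fun c hc => ?_⟩
    have := hN c hc
    simp only
    omega

theorem hasManyPairs_univ {R K : Type*} [CommRing R] [IsDomain R] [Infinite R] [Field K]
    [Algebra R K] [IsFractionRing R K] {C : Set K}
    (hC : ∃ F : ℕ → Finset K, IsDoubleFolner F ∧ 0 < upperDensity F C) :
    HasManyPairs (Set.univ : Set R) C := by
  refine ⟨hC, fun F hF hpos ε hε => ?_⟩
  obtain ⟨D, Φ, hD, h⟩ := exists_large_upperDensity_pairBases (R := R) hF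
    (Γ := nonZeroDivisors R) (fun h => nonZeroDivisors.ne_zero h rfl)
    (fun r hr => ⟨r, mem_nonZeroDivisors_of_ne_zero hr, dvd_rfl⟩)
    (by
      refine (Set.finite_singleton (0 : R)).infinite_compl.mono fun r hr => ?_
      exact mem_nonZeroDivisors_of_ne_zero hr) hpos hε
  obtain ⟨G, hG, hG'⟩ := exists_finset_translates_ne_zero Φ
  have hD0 : ∀ d ∈ D, d ≠ 0 := fun d hd => nonZeroDivisors.ne_zero (hD d hd)
  have hmem : ∀ x, (∀ c ∈ Φ, x + c ≠ 0) → ∃ d ∈ D, ∃ c ∈ Φ, d * (x + c) ∈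
      {n : R | n ∈ Set.univ ∧ n ≠ 0 ∧
        upperDensity F C ^ 2 - ε < upperDensity F (pairBases C n)} := by
    intro x hx
    obtain ⟨d, hd, c, hc, hlt⟩ := h x fun c hc => mem_nonZeroDivisors_of_ne_zero (hx c hc)
    exact ⟨d, hd, c, hc, trivial, mul_ne_zero (hD0 d hd) (hx c hc), hlt⟩
  exact isAffinelySyndetic_of_forall_exists (· ≠ 0) hD0 hmem G hG hG'

theorem hasManyPairs_nat {C : Set ℚ}
    (hC : ∃ F : ℕ → Finset ℚ, IsDoubleFolner F ∧ 0 < upperDensity F C) :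
    HasManyPairs (Set.range (fun n : ℕ => (n : ℤ))) C := by
  refine ⟨hC, fun F hF hpos ε hε => ?_⟩
  obtain ⟨D, Φ, hD, h⟩ := exists_large_upperDensity_pairBases (R := ℤ) hF
    (Γ := Submonoid.pos ℤ) (fun h => lt_irrefl 0 (Submonoid.mem_pos.1 h))
    (fun r hr => ⟨|r|, Submonoid.mem_pos.2 (abs_pos.2 hr), (dvd_abs r r).2 dvd_rfl⟩)
    (Set.Ioi_infinite (0 : ℤ)) hpos hε
  obtain ⟨G, hG, hG'⟩ := exists_finset_affine_pos Φ
  have hD0 : ∀ d ∈ D, 0 < d := fun d hd => Submonoid.mem_pos.1 (hD d hd)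
  have hmem : ∀ x, (∀ c ∈ Φ, 0 < x + c) → ∃ d ∈ D, ∃ c ∈ Φ, d * (x + c) ∈
      {n : ℤ | n ∈ Set.range (fun n : ℕ => (n : ℤ)) ∧ n ≠ 0 ∧
        upperDensity F C ^ 2 - ε < upperDensity F (pairBases C n)} := by
    intro x hx
    obtain ⟨d, hd, c, hc, hlt⟩ := h x fun c hc => Submonoid.mem_pos.2 (hx c hc)
    have hn := mul_pos (hD0 d hd) (hx c hc)
    exact ⟨d, hd, c, hc, ⟨_, Int.toNat_of_nonneg hn.le⟩, hn.ne', hlt⟩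
  exact isAffinelySyndetic_of_forall_exists (0 < ·) (fun d hd => (hD0 d hd).ne') hmem G hG hG'

theorem exists_upperDensity_pos_of_iUnion_eq_univ {K : Type*} [Field K] [Infinite K] [Countable K]
    {r : ℕ} {C : Fin r → Set K} (hC : (⋃ i, C i) = Set.univ) :
    ∃ i, ∃ F : ℕ → Finset K, IsDoubleFolner F ∧ 0 < upperDensity F (C i) := by
  obtain ⟨F, hF, hne⟩ := exists_isDoubleFolner K
  obtain ⟨i, hi⟩ := exists_upperDensity_pos hne hC
  exact ⟨i, F, hF, hi⟩

theorem countable_of_isFractionRing (R K : Type*) [CommRing R] [IsDomain R] [Field K] [Algebra R K]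
    [IsFractionRing R K] [Countable R] : Countable K :=
  Function.Surjective.countable (f := fun q : R × R => algebraMap R K q.1 / algebraMap R K q.2)
    fun k => by
      obtain ⟨a, b, -, h⟩ := IsFractionRing.div_surjective (A := R) k
      exact ⟨(a, b), h⟩

theorem mainTheorem5 :
    (∀ (r : ℕ) (C : Fin r → Set ℚ), (⋃ i, C i) = Set.univ →
      ∃ i, HasManyPairs (Set.range (fun n : ℕ => (n : ℤ))) (C i)) ∧
    (∀ (K : Type*) [Field K] [NumberField K] (r : ℕ) (C : Fin r → Set K),
      (⋃ i, C i) = Set.univ → ∃ i, HasManyPairs (Set.univ : Set (𝓞 K)) (C i)) ∧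
    (∀ (F : Type*) [Field F] [Finite F] (r : ℕ) (C : Fin r → Set (RatFunc F)),
      (⋃ i, C i) = Set.univ → ∃ i, HasManyPairs (Set.univ : Set F[X]) (C i)) := by
  refine ⟨fun r C hC => ?_, fun K _ _ r C hC => ?_, fun F _ _ r C hC => ?_⟩
  · obtain ⟨i, hi⟩ := exists_upperDensity_pos_of_iUnion_eq_univ hC
    exact ⟨i, hasManyPairs_nat hi⟩
  · have : Countable K := (Module.finBasis ℚ K).equivFun.toEquiv.injective.countable
    have : Infinite K := CharZero.infinite K
    have : Infinite (𝓞 K) := CharZero.infinite (𝓞 K)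
    obtain ⟨i, hi⟩ := exists_upperDensity_pos_of_iUnion_eq_univ hC
    exact ⟨i, hasManyPairs_univ hi⟩
  · have : Countable F[X] := by
      rw [← Cardinal.mk_le_aleph0_iff]
      exact Polynomial.cardinalMk_le_max.trans (max_le Cardinal.mk_le_aleph0 le_rfl)
    have : Countable (RatFunc F) := countable_of_isFractionRing F[X] (RatFunc F)
    have : Infinite (RatFunc F) := Infinite.of_injective _ (IsFractionRing.injective F[X] _)
    obtain ⟨i, hi⟩ := exists_upperDensity_pos_of_iUnion_eq_univ hC
    exact ⟨i, hasManyPairs_univ hi⟩
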